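/- Let $N\ge 2$ be an integer, and let $$U(x)=\log\frac{C_N}{\bigl(1+|x|^{\frac{N}{N-1}}\bigr)^N},\quad x\in\mathbb{R}^N,\qquad C_N=N\Bigl(\frac{N^2}{N-1}\Bigr)^{N-1},$$ be the Liouville bubble, a solution of $-\operatorname{div}(|\nabla U|^{N-2}\nabla U)=e^U$ in $\mathbb{R}^N$. Let $$L(\varphi)=\operatorname{div}\bigl(|\nabla U|^{N-2}\nabla\varphi\bigr)+(N-2)\operatorname{div}\bigl(|\nabla U|^{N-4}(\nabla U\cdot\nabla\varphi)\nabla U\bigr)+e^U\varphi$$ be the linearized operator at $U$, and let $Z_0(x)=x\cdot\nabla U(x)+N$ and $Z_i=\frac{\partial U}{\partial x_i}$ for $i=1,\dots,N$. Let $\varphi\in L^\infty(\mathbb{R}^N)$ be a real-valued function that is continuous on $\mathbb{R}^N$ and $C^2$ on $\mathbb{R}^N\setminus\{0\}$ (for instance, any $\varphi\in L^\infty\cap C^2(\mathbb{R}^N)$), and suppose that $L(\varphi)=0$ pointwise in $\mathbb{R}^N\setminus\{0\}$. Then $\varphi$ is a linear combination of $Z_0,Z_1,\dots,Z_N$: there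 are $c_0,c_1,\dots,c_N\in\mathbb{R}$ with $\varphi=\sum_{i=0}^N c_iZ_i$ on $\mathbb{R}^N$. -/

import Mathlib

open MeasureTheory
open scoped ENNReal

noncomputable section

namespace NLiouville

/-- `ℝ^N` with its Euclidean norm and inner product. -/
abbrev E (N : ℕ) : Type := EuclideanSpace ℝ (Fin N)

/-- The constant `C_N = N (N² / (N - 1))^(N - 1)`. -/
def constC (N : ℕ) : ℝ := (N : ℝ) * ((N : ℝ) ^ 2 / ((N : ℝ) - 1)) ^ (N - 1)

/-- The Liouville bubble `U(x) = log (C_N / (1 + |x|^(N/(N-1)))^N)`. -/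
def bubble (N : ℕ) (x : E N) : ℝ :=
  Real.log (constC N / (1 + ‖x‖ ^ ((N : ℝ) / ((N : ℝ) - 1))) ^ N)

/-- The partial derivative `∂f/∂x_i`. -/
def partialDeriv {N : ℕ} (i : Fin N) (f : E N → ℝ) (x : E N) : ℝ :=
  fderiv ℝ f x (EuclideanSpace.single i 1)

/-- The divergence `∑ i, ∂V_i/∂x_i` of a vector field. -/
def divergence {N : ℕ} (V : E N → E N) (x : E N) : ℝ :=
  ∑ i, partialDeriv i (fun y => V y i) x

/-- The linearization at `U` of `u ↦ div (|∇u|^(N-2) ∇u) + e^u`: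
`L φ = div (|∇U|^(N-2) ∇φ) + (N-2) div (|∇U|^(N-4) (∇U ⬝ ∇φ) ∇U) + e^U φ`. -/
def linearizedOp (N : ℕ) (φ : E N → ℝ) (x : E N) : ℝ :=
  divergence (fun y => ‖gradient (bubble N) y‖ ^ ((N : ℝ) - 2) • gradient φ y) x
    + ((N : ℝ) - 2) *
      divergence (fun y =>
        (‖gradient (bubble N) y‖ ^ ((N : ℝ) - 4)
          * inner ℝ (gradient (bubble N) y) (gradient φ y)) • gradient (bubble N) y) x
    + Real.exp (bubble N x) * φ x

/-- `Z_0(x) = x ⬝ ∇U(x) + N`, generated by the scaling invariance. -/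
def Zscale (N : ℕ) (x : E N) : ℝ := inner ℝ x (gradient (bubble N) x) + (N : ℝ)

/-- `Z_i = ∂U/∂x_i`, generated by the translation invariance. -/
def Ztrans (N : ℕ) (i : Fin N) (x : E N) : ℝ := partialDeriv i (bubble N) x

end NLiouville

end

/-!
# Nondegeneracy of the Liouville bubble

In the variables `s = p log |x|`, `p = N / (N - 1)`, and `ω = x / |x|` the equation `L φ = 0` reads
`φ_ss + (N - 2) (1 - σ) φ_s + N σ (1 - σ) φ + (N - 1) / N² Δ_S φ = 0` with `σ` the sigmoid function
of `s`. The moments `∫ φ(s, ω) ⟨a, ω⟩^k dω` satisfy a triangular system of ordinary differential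
equations, whose bounded solutions are classified with the help of Wronskians.
-/

noncomputable section

namespace NLiouville

open Real Filter Topology

/-! In the variables `s = p log |x|`, `ω = x / |x|` the equation separates, with spectral parameter
`(N - 1) / N ^ 2` times an eigenvalue of `-Δ_S`. Degree 0 gives the parameter 0, solved by the
profile of `Z_0`. Degree 1 gives `(N - 1) ^ 2 / N ^ 2`, solved by the profile of the `Z_i`, which is
positive. Every higher degree gives a larger parameter.

A positive solution that is bounded and flat at both ends is a ground state, so bounded solutions
with a larger parameter vanish (`IsRadialSol.eq_zero_of_lt`). For the two low parameters the
Wronskian shows that bounded solutions are multiples of the explicit one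
(`IsRadialSol.eq_const_mul`).

Spherical harmonics are avoided. Since `Δ_S` maps `⟨a, ω⟩ ^ k` to a combination of itself and `⟨a,
ω⟩ ^ (k - 2)`, the moments of `φ` against these powers solve radial equations with a source two
degrees lower (`moment_equation`). The moments of degrees 0 and 1 determine an element of the
kernel; once it is subtracted, induction on `k` removes the source and the comparison kills every
higher moment (`moments_eq_kernelPart`). A continuous function on the sphere with zero moments is
zero (`eq_zero_of_moments`), so `φ` equals that element on each sphere. -/

/-! ### The radial equation: Wronskians, uniqueness and comparison. -/

/-- `f`, with first and second derivatives `f₁` and `f₂`, solves the radial equation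
`f'' + (N - 2) (1 - σ) f' + N σ (1 - σ) f = lam f`, where `σ` is the sigmoid function. -/
structure IsRadialSol (N : ℕ) (lam : ℝ) (f f₁ f₂ : ℝ → ℝ) : Prop where
  hasDerivAt : ∀ s, HasDerivAt f (f₁ s) s
  hasDerivAt' : ∀ s, HasDerivAt f₁ (f₂ s) s
  eqn : ∀ s, f₂ s + ((N : ℝ) - 2) * (1 - sigmoid s) * f₁ s
    + N * (sigmoid s * (1 - sigmoid s)) * f s = lam * f s

/-- The weight `σ^(N-2)` that makes the radial equation self-adjoint. -/
def radialWeight (N : ℕ) (s : ℝ) : ℝ := sigmoid s ^ (N - 2)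

lemma radialWeight_pos (N : ℕ) (s : ℝ) : 0 < radialWeight N s := pow_pos (sigmoid_pos s) _

lemma radialWeight_le_one (N : ℕ) (s : ℝ) : radialWeight N s ≤ 1 :=
  pow_le_one₀ (sigmoid_nonneg s) (sigmoid_le_one s)

lemma hasDerivAt_radialWeight {N : ℕ} (hN : 2 ≤ N) (s : ℝ) :
    HasDerivAt (radialWeight N) (((N : ℝ) - 2) * (1 - sigmoid s) * radialWeight N s) s := by
  obtain ⟨n, rfl⟩ := Nat.exists_eq_add_of_le' hN
  have h := (hasDerivAt_sigmoid s).pow n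
  refine h.congr_deriv ?_
  simp only [radialWeight, Nat.add_sub_cancel]
  rcases n with _ | n
  · simp
  · push_cast
    ring

/-- The weighted Wronskian of two functions. -/
def wronskian (N : ℕ) (f f₁ g g₁ : ℝ → ℝ) (s : ℝ) : ℝ :=
  radialWeight N s * (f₁ s * g s - f s * g₁ s)

/-- Lagrange's identity: the weight absorbs the first-order terms and the zeroth-order coefficient
cancels, which leaves only the gap between the parameters. -/
lemma hasDerivAt_wronskian {N : ℕ} (hN : 2 ≤ N) {lam mu : ℝ} {f f₁ f₂ g g₁ g₂ : ℝ → ℝ}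
    (hf : IsRadialSol N lam f f₁ f₂) (hg : IsRadialSol N mu g g₁ g₂) (s : ℝ) :
    HasDerivAt (wronskian N f f₁ g g₁) ((lam - mu) * radialWeight N s * (f s * g s)) s := by
  have h := (hasDerivAt_radialWeight hN s).mul
    (((hf.hasDerivAt' s).mul (hg.hasDerivAt s)).sub ((hf.hasDerivAt s).mul (hg.hasDerivAt' s)))
  refine h.congr_deriv ?_
  have e1 := hf.eqn s
  have e2 := hg.eqn s
  simp only [Pi.sub_apply, Pi.mul_apply]
  linear_combination radialWeight N s * (g s * e1 - f s * e2)

/-- The derivative of a bounded function tends to zero along some sequence going to `+∞`. -/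
lemma exists_seq_deriv_tendsto_zero_atTop {f f₁ : ℝ → ℝ} (hf : ∀ s, HasDerivAt f (f₁ s) s)
    {B : ℝ} (hB : ∀ s, |f s| ≤ B) :
    ∃ ξ : ℕ → ℝ, Tendsto ξ atTop atTop ∧ Tendsto (fun n => f₁ (ξ n)) atTop (𝓝 0) := by
  have key : ∀ n : ℕ, ∃ x : ℝ, (n : ℝ) ≤ x ∧ |f₁ x| ≤ 2 * B / (n + 1) := by
    intro n
    have hn : (0 : ℝ) < (n : ℝ) + 1 := by positivity
    -- The interval `[n, 2n + 1]` has length `n + 1`, so a function bounded by `B` has slope at most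
    -- `2B / (n + 1)` over it.
    obtain ⟨x, hx, h⟩ := exists_hasDerivAt_eq_slope f f₁ (a := n) (b := n + (n + 1))
      (by linarith) (fun y _ => (hf y).continuousAt.continuousWithinAt) (fun y _ => hf y)
    refine ⟨x, hx.1.le, ?_⟩
    rw [h, add_sub_cancel_left, abs_div, abs_of_pos hn]
    gcongr
    calc |f (n + (n + 1)) - f n| ≤ |f (n + (n + 1))| + |f n| := abs_sub _ _
      _ ≤ 2 * B := by linarith [hB (n + (n + 1)), hB n]
  choose ξ h1 h2 using key
  refine ⟨ξ, tendsto_atTop_mono h1 tendsto_natCast_atTop_atTop, ?_⟩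
  refine squeeze_zero_norm h2 ?_
  exact tendsto_const_nhds.div_atTop
    (tendsto_atTop_add_const_right _ _ tendsto_natCast_atTop_atTop)

lemma exists_seq_deriv_tendsto_zero_atBot {f f₁ : ℝ → ℝ} (hf : ∀ s, HasDerivAt f (f₁ s) s)
    {B : ℝ} (hB : ∀ s, |f s| ≤ B) :
    ∃ ξ : ℕ → ℝ, Tendsto ξ atTop atBot ∧ Tendsto (fun n => f₁ (ξ n)) atTop (𝓝 0) := by
  obtain ⟨ξ, h1, h2⟩ := exists_seq_deriv_tendsto_zero_atTop (f := fun s => f (-s))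
    (f₁ := fun s => - f₁ (-s)) (B := B)
    (fun s => ((hf (-s)).comp s (hasDerivAt_neg s)).congr_deriv (by ring)) (fun s => hB _)
  exact ⟨fun n => - ξ n, tendsto_neg_atTop_atBot.comp h1, by simpa using h2.neg⟩

/-- Boundedness of `f` controls `f₁` only along a sequence. This is enough, since the Wronskians
used later are constant or have monotone squares. -/
lemma tendsto_wronskian_zero {N : ℕ} {f f₁ g g₁ : ℝ → ℝ} {B C : ℝ}
    (hB : ∀ s, |f s| ≤ B) (hC : ∀ s, |g s| ≤ C) {l : Filter ℝ} (hg : Tendsto g₁ l (𝓝 0))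
    {ξ : ℕ → ℝ} (hξ : Tendsto ξ atTop l) (hf : Tendsto (fun n => f₁ (ξ n)) atTop (𝓝 0)) :
    Tendsto (fun n => wronskian N f f₁ g g₁ (ξ n)) atTop (𝓝 0) := by
  have hg' : Tendsto (fun n => g₁ (ξ n)) atTop (𝓝 0) := hg.comp hξ
  have hlim : Tendsto (fun n => |f₁ (ξ n)| * C + B * |g₁ (ξ n)|) atTop (𝓝 0) := by
    simpa using (hf.abs.mul_const C).add (hg'.abs.const_mul B)
  refine squeeze_zero_norm (fun n => ?_) hlim
  rw [wronskian, norm_mul, Real.norm_eq_abs, Real.norm_eq_abs, abs_of_pos (radialWeight_pos _ _)]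
  calc radialWeight N (ξ n) * |f₁ (ξ n) * g (ξ n) - f (ξ n) * g₁ (ξ n)|
      ≤ 1 * |f₁ (ξ n) * g (ξ n) - f (ξ n) * g₁ (ξ n)| := by
        gcongr; exact radialWeight_le_one _ _
    _ ≤ |f₁ (ξ n) * g (ξ n)| + |f (ξ n) * g₁ (ξ n)| := by rw [one_mul]; exact abs_sub _ _
    _ ≤ _ := by
        rw [abs_mul, abs_mul]
        gcongr
        · exact hC _
        · exact hB _

/-- Two bounded solutions of the same radial equation are linearly dependent as soon as the
derivative of one of them vanishes at `+∞`. -/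
lemma wronskian_eq_zero {N : ℕ} (hN : 2 ≤ N) {lam : ℝ} {f f₁ f₂ g g₁ g₂ : ℝ → ℝ}
    (hf : IsRadialSol N lam f f₁ f₂) (hg : IsRadialSol N lam g g₁ g₂) {B C : ℝ}
    (hB : ∀ s, |f s| ≤ B) (hC : ∀ s, |g s| ≤ C) (hg0 : Tendsto g₁ atTop (𝓝 0)) (s : ℝ) :
    f₁ s * g s - f s * g₁ s = 0 := by
  obtain ⟨ξ, h1, h2⟩ := exists_seq_deriv_tendsto_zero_atTop hf.hasDerivAt hB
  have h3 := tendsto_wronskian_zero (N := N) hB hC hg0 h1 h2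
  have hconst : ∀ t, wronskian N f f₁ g g₁ t = wronskian N f f₁ g g₁ s := fun t =>
    is_const_of_deriv_eq_zero (fun x => (hasDerivAt_wronskian hN hf hg x).differentiableAt)
      (fun x => by rw [(hasDerivAt_wronskian hN hf hg x).deriv]; ring) t s
  simp only [hconst] at h3
  have h0 : wronskian N f f₁ g g₁ s = 0 := tendsto_nhds_unique tendsto_const_nhds h3
  exact (mul_eq_zero.1 h0).resolve_left (radialWeight_pos N s).ne'

lemma IsRadialSol.sub_const_mul {N : ℕ} {lam : ℝ} {f f₁ f₂ g g₁ g₂ : ℝ → ℝ}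
    (hf : IsRadialSol N lam f f₁ f₂) (hg : IsRadialSol N lam g g₁ g₂) (c : ℝ) :
    IsRadialSol N lam (fun s => f s - c * g s) (fun s => f₁ s - c * g₁ s)
      (fun s => f₂ s - c * g₂ s) where
  hasDerivAt s := (hf.hasDerivAt s).sub ((hg.hasDerivAt s).const_mul c)
  hasDerivAt' s := (hf.hasDerivAt' s).sub ((hg.hasDerivAt' s).const_mul c)
  eqn s := by linear_combination hf.eqn s - c * hg.eqn s

/-- Uniqueness for the Cauchy problem of the radial equation. -/
lemma IsRadialSol.eq_zero_of_cauchy {N : ℕ} (hN : 2 ≤ N) {lam : ℝ} {f f₁ f₂ : ℝ → ℝ}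
    (hf : IsRadialSol N lam f f₁ f₂) {a : ℝ} (h0 : f a = 0) (h1 : f₁ a = 0) (s : ℝ) :
    f s = 0 := by
  have hN' : (2 : ℝ) ≤ N := by exact_mod_cast hN
  -- Grönwall's inequality for the energy `f² + f₁²`: the cross term contributes `1 + |lam| + N` to
  -- the constant and the damping term `2N`.
  set K : ℝ := 1 + 3 * N + |lam| with hK
  set e : ℝ → ℝ := fun t => f t ^ 2 + f₁ t ^ 2 with he
  set e' : ℝ → ℝ := fun t => 2 * f t * f₁ t + 2 * f₁ t * f₂ t with he'
  have hder : ∀ t, HasDerivAt e (e' t) t := fun t => by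
    refine (((hf.hasDerivAt t).pow 2).add ((hf.hasDerivAt' t).pow 2)).congr_deriv ?_
    simp [he']
  have hbound : ∀ t, |e' t| ≤ K * e t := fun t => by
    have hs0 := sigmoid_pos t
    have hs1 := sigmoid_lt_one t
    set b : ℝ := 1 + lam - N * (sigmoid t * (1 - sigmoid t)) with hb
    set d : ℝ := ((N : ℝ) - 2) * (1 - sigmoid t) with hd
    have hq : e' t = 2 * (f t * f₁ t) * b - 2 * d * f₁ t ^ 2 := by
      simp only [he', hb, hd]
      linear_combination 2 * f₁ t * hf.eqn t
    have hd0 : 0 ≤ d := mul_nonneg (by linarith) (by linarith)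
    have hd1 : d ≤ N := by
      have : d ≤ ((N : ℝ) - 2) * 1 := mul_le_mul_of_nonneg_left (by linarith) (by linarith)
      linarith
    have hss : sigmoid t * (1 - sigmoid t) ≤ 1 := by nlinarith
    have hss0 : 0 ≤ sigmoid t * (1 - sigmoid t) := mul_nonneg hs0.le (by linarith)
    have hbb : |b| ≤ 1 + |lam| + N := by
      rw [abs_le]
      constructor
      · nlinarith [neg_abs_le lam]
      · nlinarith [le_abs_self lam]
    have hxy : |2 * (f t * f₁ t)| ≤ e t := by
      rw [abs_le]
      constructor
      · simp only [he]; nlinarith [sq_nonneg (f t + f₁ t)]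
      · simp only [he]; nlinarith [sq_nonneg (f t - f₁ t)]
    have hy : f₁ t ^ 2 ≤ e t := by simp only [he]; nlinarith [sq_nonneg (f t)]
    calc |e' t| ≤ |2 * (f t * f₁ t) * b| + |2 * d * f₁ t ^ 2| := by rw [hq]; exact abs_sub _ _
      _ ≤ e t * (1 + |lam| + N) + 2 * N * e t := by
        rw [abs_mul]
        refine add_le_add (mul_le_mul hxy hbb (abs_nonneg _) ((sq_nonneg _).trans hy)) ?_
        rw [abs_of_nonneg (by positivity)]
        gcongr
      _ = K * e t := by rw [hK]; ring
  have hea : e a = 0 := by simp [he, h0, h1]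
  have hexp : ∀ (κ t : ℝ), HasDerivAt (fun t => e t * exp (κ * t))
      ((e' t + κ * e t) * exp (κ * t)) t := fun κ t => by
    have h := (hder t).mul (((hasDerivAt_id t).const_mul κ).exp)
    refine h.congr_deriv ?_
    simp only [id]
    ring
  -- To the right of `a` the function `e * exp (-K t)` decreases, to the left `e * exp (K t)`
  -- increases; both vanish at `a`.
  have hle : e s ≤ 0 := by
    rcases le_total a s with h | h
    · have hanti : Antitone (fun t => e t * exp (-K * t)) :=
        antitone_of_hasDerivAt_nonpos (hexp (-K)) fun t =>
          mul_nonpos_of_nonpos_of_nonneg (by linarith [(abs_le.1 (hbound t)).2]) (exp_pos _).le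
      have := hanti h
      simp only [hea, zero_mul] at this
      exact nonpos_of_mul_nonpos_left this (exp_pos _)
    · have hmono : Monotone (fun t => e t * exp (K * t)) :=
        monotone_of_hasDerivAt_nonneg (hexp K) fun t =>
          mul_nonneg (by linarith [(abs_le.1 (hbound t)).1]) (exp_pos _).le
      have := hmono h
      simp only [hea, zero_mul] at this
      exact nonpos_of_mul_nonpos_left this (exp_pos _)
  simp only [he] at hle
  nlinarith [sq_nonneg (f s), sq_nonneg (f₁ s)]

/-- Subtracting the multiple of `g` that matches `f` at `a` also matches the derivatives there,
because the Wronskian vanishes; Cauchy uniqueness does the rest. -/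
lemma IsRadialSol.eq_const_mul {N : ℕ} (hN : 2 ≤ N) {lam : ℝ} {f f₁ f₂ g g₁ g₂ : ℝ → ℝ}
    (hf : IsRadialSol N lam f f₁ f₂) (hg : IsRadialSol N lam g g₁ g₂) {B C : ℝ}
    (hB : ∀ s, |f s| ≤ B) (hC : ∀ s, |g s| ≤ C) (hg0 : Tendsto g₁ atTop (𝓝 0))
    {a : ℝ} (ha : g a ≠ 0) (s : ℝ) : f s = f a / g a * g s := by
  have hW := wronskian_eq_zero hN hf hg hB hC hg0 a
  have h := (hf.sub_const_mul hg (f a / g a)).eq_zero_of_cauchy hN (a := a)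
    (by field_simp; ring) (by field_simp; linear_combination hW) s
  linarith

/-- A bounded solution vanishes if its eigenvalue is larger than that of a positive bounded
solution whose derivative vanishes at both ends. -/
lemma IsRadialSol.eq_zero_of_lt {N : ℕ} (hN : 2 ≤ N) {lam mu : ℝ} {f f₁ f₂ g g₁ g₂ : ℝ → ℝ}
    (hf : IsRadialSol N lam f f₁ f₂) (hg : IsRadialSol N mu g g₁ g₂) {B C : ℝ}
    (hB : ∀ s, |f s| ≤ B) (hC : ∀ s, |g s| ≤ C) (hpos : ∀ s, 0 < g s)
    (hg0 : Tendsto g₁ atTop (𝓝 0)) (hg1 : Tendsto g₁ atBot (𝓝 0)) (hlt : mu < lam) (s : ℝ) :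
    f s = 0 := by
  set W := wronskian N f f₁ g g₁ with hW
  have hder : ∀ t, HasDerivAt W ((lam - mu) * radialWeight N t * (f t * g t)) t :=
    hasDerivAt_wronskian hN hf hg
  have hl : 0 < lam - mu := by linarith
  -- `P = W f / g` is monotone
  have hP : Monotone (fun t => W t * (f t / g t)) := by
    refine monotone_of_hasDerivAt_nonneg
      (fun t => (hder t).mul ((hf.hasDerivAt t).div (hg.hasDerivAt t) (hpos t).ne')) fun t => ?_
    have h1 : (lam - mu) * radialWeight N t * (f t * g t) * (f t / g t)
        = (lam - mu) * radialWeight N t * f t ^ 2 := by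
      have := (hpos t).ne'
      field_simp
    have h2 : W t * ((f₁ t * g t - f t * g₁ t) / g t ^ 2)
        = radialWeight N t * ((f₁ t * g t - f t * g₁ t) / g t) ^ 2 := by
      have := (hpos t).ne'
      simp only [hW, wronskian]
      field_simp
    show 0 ≤ _ + _
    rw [h1, h2]
    have := radialWeight_pos N t
    positivity
  -- Writing `f g = g² (f / g)` shows that the derivative of `W²` has the sign of `P`.
  have hsq : ∀ t, HasDerivAt (fun t => W t ^ 2)
      (2 * (lam - mu) * radialWeight N t * g t ^ 2 * (W t * (f t / g t))) t := fun t => by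
    refine ((hder t).pow 2).congr_deriv ?_
    have := (hpos t).ne'
    field_simp
    simp
    ring
  have hcont : Continuous (fun t => W t ^ 2) :=
    continuous_iff_continuousAt.2 fun t => (hsq t).continuousAt
  -- It suffices that `W` vanish on a half-line ending at `s`: its one-sided derivative at `s` is a
  -- nonzero multiple of `f s`.
  have hfin : ∀ D : Set ℝ, UniqueDiffWithinAt ℝ D s → s ∈ D → (∀ t ∈ D, W t = 0) → f s = 0 := by
    intro D hD hs h
    have h1 := (hder s).hasDerivWithinAt (s := D)
    have h2 : HasDerivWithinAt W 0 D s := (hasDerivWithinAt_const s D 0).congr h (h s hs)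
    have h3 := hD.eq_deriv _ h1 h2
    have := radialWeight_pos N s
    have := hpos s
    have hne : (lam - mu) * radialWeight N s * g s ≠ 0 := by positivity
    have : (lam - mu) * radialWeight N s * g s * f s = 0 := by linarith
    exact (mul_eq_zero.1 this).resolve_left hne
  -- Monotonicity propagates the sign of `P s` to one of the two half-lines. There `W²` is monotone
  -- away from `s`, so its zero limit along `ξ` forces it to vanish.
  rcases le_total 0 (W s * (f s / g s)) with h | h
  · obtain ⟨ξ, h1, h2⟩ := exists_seq_deriv_tendsto_zero_atTop hf.hasDerivAt hB
    have h3 := (tendsto_wronskian_zero (N := N) hB hC hg0 h1 h2).pow 2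
    have hmono : MonotoneOn (fun t => W t ^ 2) (Set.Ici s) := by
      refine monotoneOn_of_hasDerivWithinAt_nonneg (convex_Ici s) hcont.continuousOn
        (fun t _ => (hsq t).hasDerivWithinAt) fun t ht => ?_
      have := radialWeight_pos N t
      refine mul_nonneg (by positivity) (h.trans (hP ?_))
      exact interior_subset ht
    refine hfin (Set.Ici s) (uniqueDiffOn_Ici s s Set.self_mem_Ici) Set.self_mem_Ici fun t ht => ?_
    have : W t ^ 2 ≤ 0 ^ 2 := by
      refine ge_of_tendsto h3 ?_
      filter_upwards [h1.eventually_ge_atTop t] with n hn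
      exact hmono ht (Set.mem_Ici.2 (le_trans ht hn)) hn
    nlinarith
  · obtain ⟨ξ, h1, h2⟩ := exists_seq_deriv_tendsto_zero_atBot hf.hasDerivAt hB
    have h3 := (tendsto_wronskian_zero (N := N) hB hC hg1 h1 h2).pow 2
    have hanti : AntitoneOn (fun t => W t ^ 2) (Set.Iic s) := by
      refine antitoneOn_of_hasDerivWithinAt_nonpos (convex_Iic s) hcont.continuousOn
        (fun t _ => (hsq t).hasDerivWithinAt) fun t ht => ?_
      have := radialWeight_pos N t
      refine mul_nonpos_of_nonneg_of_nonpos (by positivity) ((hP ?_).trans h)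
      exact (interior_subset ht : t ∈ Set.Iic s)
    refine hfin (Set.Iic s) (uniqueDiffOn_Iic s s Set.self_mem_Iic) Set.self_mem_Iic fun t ht => ?_
    have : W t ^ 2 ≤ 0 ^ 2 := by
      refine ge_of_tendsto h3 ?_
      filter_upwards [h1.eventually_le_atBot t] with n hn
      exact hanti (Set.mem_Iic.2 (le_trans hn ht)) ht hn
    nlinarith

/-! ### Explicit profiles and the classification of bounded radial solutions. -/

/-- The radial profile of `Z_0`, up to a factor. -/
def scaleProfile (N : ℕ) (s : ℝ) : ℝ := 1 - (N : ℝ) / ((N : ℝ) - 1) * sigmoid s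

/-- The radial profile of `Z_1, …, Z_N`, up to a factor. -/
def transProfile (N : ℕ) (s : ℝ) : ℝ := exp (s / N) * (1 - sigmoid s)

lemma isRadialSol_scaleProfile {N : ℕ} (hN : 2 ≤ N) :
    IsRadialSol N 0 (scaleProfile N)
      (fun s => -((N : ℝ) / ((N : ℝ) - 1)) * (sigmoid s * (1 - sigmoid s)))
      (fun s => -((N : ℝ) / ((N : ℝ) - 1)) *
        (sigmoid s * (1 - sigmoid s) * (1 - 2 * sigmoid s))) where
  hasDerivAt s := by
    refine (((hasDerivAt_sigmoid s).const_mul _).const_sub 1).congr_deriv ?_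
    ring
  hasDerivAt' s := by
    refine (((hasDerivAt_sigmoid s).mul ((hasDerivAt_sigmoid s).const_sub 1)).const_mul
      (-((N : ℝ) / ((N : ℝ) - 1)))).congr_deriv ?_
    ring
  eqn s := by
    have : (2 : ℝ) ≤ N := by exact_mod_cast hN
    have : (N : ℝ) - 1 ≠ 0 := by linarith
    simp only [scaleProfile]
    field_simp
    ring

lemma hasDerivAt_transProfile (N : ℕ) (s : ℝ) :
    HasDerivAt (transProfile N) (transProfile N s * (1 / N - sigmoid s)) s := by
  refine ((((hasDerivAt_id s).div_const (N : ℝ)).exp).mul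
    ((hasDerivAt_sigmoid s).const_sub 1)).congr_deriv ?_
  simp only [transProfile, id]
  ring

/-- The parameter is `(N - 1) / N ^ 2` times `N - 1`, the eigenvalue of `-Δ_S` on linear functions.
-/
lemma isRadialSol_transProfile {N : ℕ} (hN : 2 ≤ N) :
    IsRadialSol N (((N : ℝ) - 1) ^ 2 / N ^ 2) (transProfile N)
      (fun s => transProfile N s * (1 / N - sigmoid s))
      (fun s => transProfile N s * ((1 / N - sigmoid s) ^ 2 - sigmoid s * (1 - sigmoid s))) where
  hasDerivAt := hasDerivAt_transProfile N
  hasDerivAt' s := by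
    refine ((hasDerivAt_transProfile N s).mul
      ((hasDerivAt_sigmoid s).const_sub (1 / (N : ℝ)))).congr_deriv ?_
    ring
  eqn s := by
    have : (2 : ℝ) ≤ N := by exact_mod_cast hN
    have : (N : ℝ) ≠ 0 := by linarith
    field_simp
    ring

lemma transProfile_pos (N : ℕ) (s : ℝ) : 0 < transProfile N s :=
  mul_pos (exp_pos _) (by linarith [sigmoid_lt_one s])

lemma transProfile_eq (N : ℕ) (s : ℝ) : transProfile N s = exp (s / N) / (1 + exp s) := by
  rw [transProfile, ← sigmoid_neg, sigmoid_def, neg_neg, ← div_eq_mul_inv]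

/-- This bound decays at `-∞` and `transProfile_le_right` at `+∞`; together they give boundedness
and both limits. -/
lemma transProfile_le_left (N : ℕ) (s : ℝ) : transProfile N s ≤ exp (s / N) := by
  rw [transProfile]
  exact mul_le_of_le_one_right (exp_pos _).le (by linarith [sigmoid_pos s])

lemma transProfile_le_right (N : ℕ) (s : ℝ) : transProfile N s ≤ exp (s / N - s) := by
  rw [transProfile_eq, exp_sub]
  gcongr
  linarith

lemma abs_transProfile_le {N : ℕ} (hN : 2 ≤ N) (s : ℝ) : |transProfile N s| ≤ 1 := by
  have hN' : (2 : ℝ) ≤ N := by exact_mod_cast hN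
  rw [abs_of_pos (transProfile_pos N s)]
  rcases le_total s 0 with h | h
  · exact (transProfile_le_left N s).trans
      (exp_le_one_iff.2 (div_nonpos_of_nonpos_of_nonneg h (by linarith)))
  · refine (transProfile_le_right N s).trans (exp_le_one_iff.2 ?_)
    have : s / N ≤ s := div_le_self h (by linarith)
    linarith

lemma tendsto_transProfile_atBot {N : ℕ} (hN : 2 ≤ N) :
    Tendsto (transProfile N) atBot (𝓝 0) := by
  have hN' : (0 : ℝ) < N := by positivity
  refine squeeze_zero (fun s => (transProfile_pos N s).le) (transProfile_le_left N) ?_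
  exact tendsto_exp_atBot.comp (tendsto_id.atBot_div_const hN')

lemma tendsto_transProfile_atTop {N : ℕ} (hN : 2 ≤ N) :
    Tendsto (transProfile N) atTop (𝓝 0) := by
  have hN' : (2 : ℝ) ≤ N := by exact_mod_cast hN
  refine squeeze_zero (fun s => (transProfile_pos N s).le) (transProfile_le_right N) ?_
  refine tendsto_exp_atBot.comp ?_
  have : (fun s : ℝ => s / N - s) = fun s => (1 / (N : ℝ) - 1) * s := by ext s; ring
  rw [this]
  refine tendsto_id.const_mul_atTop_of_neg ?_
  have : 1 / (N : ℝ) ≤ 1 / 2 := by gcongr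
  linarith

lemma tendsto_deriv_transProfile_atTop {N : ℕ} (hN : 2 ≤ N) :
    Tendsto (fun s => transProfile N s * (1 / N - sigmoid s)) atTop (𝓝 0) := by
  simpa using (tendsto_transProfile_atTop hN).mul
    (tendsto_const_nhds (x := 1 / (N : ℝ)) |>.sub tendsto_sigmoid_atTop)

lemma tendsto_deriv_transProfile_atBot {N : ℕ} (hN : 2 ≤ N) :
    Tendsto (fun s => transProfile N s * (1 / N - sigmoid s)) atBot (𝓝 0) := by
  simpa using (tendsto_transProfile_atBot hN).mul
    (tendsto_const_nhds (x := 1 / (N : ℝ)) |>.sub tendsto_sigmoid_atBot)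

lemma abs_scaleProfile_le {N : ℕ} (hN : 2 ≤ N) (s : ℝ) :
    |scaleProfile N s| ≤ 1 + (N : ℝ) / ((N : ℝ) - 1) := by
  have hN' : (2 : ℝ) ≤ N := by exact_mod_cast hN
  have hp0 : 0 < (N : ℝ) / ((N : ℝ) - 1) := div_pos (by linarith) (by linarith)
  rw [scaleProfile, abs_le]
  have h0 := sigmoid_pos s
  have h1 := sigmoid_le_one s
  constructor <;> nlinarith

/-- Bounded solutions with eigenvalue zero. -/
lemma IsRadialSol.eq_scaleProfile {N : ℕ} (hN : 2 ≤ N) {f f₁ f₂ : ℝ → ℝ}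
    (hf : IsRadialSol N 0 f f₁ f₂) {B : ℝ} (hB : ∀ s, |f s| ≤ B) :
    ∃ c, ∀ s, f s = c * scaleProfile N s := by
  have hN' : (2 : ℝ) ≤ N := by exact_mod_cast hN
  set p : ℝ := (N : ℝ) / ((N : ℝ) - 1) with hp
  have hp0 : 0 < p := div_pos (by linarith) (by linarith)
  have ht : Tendsto (fun s => -p * (sigmoid s * (1 - sigmoid s))) atTop (𝓝 0) := by
    simpa using (tendsto_sigmoid_atTop.mul
      (tendsto_const_nhds (x := (1 : ℝ)) |>.sub tendsto_sigmoid_atTop)).const_mul (-p)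
  -- The profile changes sign, so a point where it does not vanish has to be produced; zeros at both
  -- 0 and 1 would contradict injectivity of the sigmoid.
  obtain ⟨a, ha⟩ : ∃ a, scaleProfile N a ≠ 0 := by
    by_contra! h
    have h0 := h 0
    have h1 := h 1
    have : p * sigmoid 0 = p * sigmoid 1 := by
      simp only [scaleProfile] at h0 h1
      linarith
    exact zero_ne_one (sigmoid_injective (mul_left_cancel₀ hp0.ne' this))
  exact ⟨_, hf.eq_const_mul hN (isRadialSol_scaleProfile hN) hB (abs_scaleProfile_le hN) ht ha⟩

/-- Bounded solutions with the eigenvalue of the first spherical harmonics. -/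
lemma IsRadialSol.eq_transProfile {N : ℕ} (hN : 2 ≤ N) {f f₁ f₂ : ℝ → ℝ}
    (hf : IsRadialSol N (((N : ℝ) - 1) ^ 2 / N ^ 2) f f₁ f₂) {B : ℝ} (hB : ∀ s, |f s| ≤ B) :
    ∃ c, ∀ s, f s = c * transProfile N s :=
  ⟨_, hf.eq_const_mul hN (isRadialSol_transProfile hN) hB (abs_transProfile_le hN)
    (tendsto_deriv_transProfile_atTop hN) (transProfile_pos N 0).ne'⟩

/-- Bounded solutions with larger eigenvalues vanish. -/
lemma IsRadialSol.eq_zero {N : ℕ} (hN : 2 ≤ N) {lam : ℝ} {f f₁ f₂ : ℝ → ℝ}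
    (hf : IsRadialSol N lam f f₁ f₂) {B : ℝ} (hB : ∀ s, |f s| ≤ B)
    (hlam : ((N : ℝ) - 1) ^ 2 / N ^ 2 < lam) (s : ℝ) : f s = 0 :=
  hf.eq_zero_of_lt hN (isRadialSol_transProfile hN) hB (abs_transProfile_le hN)
    (transProfile_pos N) (tendsto_deriv_transProfile_atTop hN)
    (tendsto_deriv_transProfile_atBot hN) hlam s

/-! ### Integration on the sphere and derivatives along rotations. -/

/-- The unit sphere of `ℝ^N`. -/
abbrev Sph (N : ℕ) : Type := Metric.sphere (0 : E N) 1

/-- The surface measure of the unit sphere. -/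
abbrev sphMeasure (N : ℕ) : Measure (Sph N) := (volume : Measure (E N)).toSphere

lemma integrable_of_continuous_sphere {N : ℕ} {f : Sph N → ℝ} (hf : Continuous f) :
    Integrable f (sphMeasure N) :=
  hf.integrable_of_hasCompactSupport (HasCompactSupport.of_compactSpace f)

lemma norm_sphere {N : ℕ} (ω : Sph N) : ‖(ω : E N)‖ = 1 := by simp

lemma sphere_ne_zero {N : ℕ} (ω : Sph N) : (ω : E N) ≠ 0 := by
  rw [← norm_ne_zero_iff, norm_sphere]; exact one_ne_zero

open scoped Pointwise in
/-- The surface measure of the sphere is invariant under linear isometries. -/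
lemma integral_sphere_comp_isometry {N : ℕ} (e : E N ≃ₗᵢ[ℝ] E N) {F : E N → ℝ}
    (hF : ContinuousOn F {0}ᶜ) :
    ∫ ω : Sph N, F (e ω) ∂sphMeasure N = ∫ ω : Sph N, F ω ∂sphMeasure N := by
  let T : Sph N → Sph N := fun ω => ⟨e ω, by simp⟩
  have hTc : Continuous T := (e.continuous.comp continuous_subtype_val).subtype_mk _
  -- Up to a constant, the surface measure of `s` is the volume of the cone over `s`, so its
  -- invariance reduces to that of Lebesgue measure.
  have hT : Measure.map T (sphMeasure N) = sphMeasure N := by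
    ext s hs
    rw [Measure.map_apply hTc.measurable hs, Measure.toSphere_apply' _ (hTc.measurable hs),
      Measure.toSphere_apply' _ hs]
    congr 1
    rw [← e.measurePreserving.measure_preimage_emb e.toHomeomorph.measurableEmbedding
      (Set.Ioo (0 : ℝ) 1 • (Subtype.val '' s))]
    congr 1
    ext x
    simp only [Set.mem_preimage, Set.mem_smul, Set.mem_image]
    constructor
    · rintro ⟨r, hr, _, ⟨ω, hω, rfl⟩, rfl⟩
      exact ⟨r, hr, e ω, ⟨T ω, hω, rfl⟩, by simp⟩
    · rintro ⟨r, hr, _, ⟨ω, hω, rfl⟩, h⟩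
      refine ⟨r, hr, e.symm ω, ⟨⟨e.symm ω, by simp⟩, ?_, rfl⟩, ?_⟩
      · simpa [T] using hω
      · apply e.injective
        simpa using h
  have hFc : Continuous (fun ω : Sph N => F ω) :=
    hF.comp_continuous continuous_subtype_val sphere_ne_zero
  have := integral_map (μ := sphMeasure N) hTc.measurable.aemeasurable
    (hFc.aestronglyMeasurable (μ := Measure.map T (sphMeasure N)))
  rw [hT] at this
  exact this.symm

/-- Differentiation of an integral over a compact space. -/
lemma hasDerivAt_integral_of_continuous {X : Type*} [TopologicalSpace X] [CompactSpace X]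
    [MeasurableSpace X] [OpensMeasurableSpace X] {μ : Measure X} [IsFiniteMeasure μ]
    {F F' : ℝ → X → ℝ} (hF : ∀ s, Continuous (F s))
    (hF' : Continuous (Function.uncurry F'))
    (h : ∀ s x, HasDerivAt (fun s => F s x) (F' s x) s) (s₀ : ℝ) :
    HasDerivAt (fun s => ∫ x, F s x ∂μ) (∫ x, F' s₀ x ∂μ) s₀ := by
  have hcpt : IsCompact (Metric.closedBall s₀ 1 ×ˢ (Set.univ : Set X)) :=
    (isCompact_closedBall s₀ 1).prod isCompact_univ
  obtain ⟨C, hC⟩ := hcpt.exists_bound_of_continuousOn hF'.continuousOn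
  have hF'c : ∀ s, Continuous (F' s) := fun s => hF'.comp (Continuous.prodMk_right s)
  refine (hasDerivAt_integral_of_dominated_loc_of_deriv_le (bound := fun _ => C)
    (s := Metric.closedBall s₀ 1)
    (Metric.closedBall_mem_nhds s₀ one_pos)
    (Eventually.of_forall fun s => (hF s).aestronglyMeasurable_of_compactSpace)
    ((hF s₀).integrable_of_hasCompactSupport (HasCompactSupport.of_compactSpace _))
    (hF'c s₀).aestronglyMeasurable_of_compactSpace
    (ae_of_all _ fun x s hs => hC (s, x) ⟨hs, Set.mem_univ _⟩) (integrable_const C)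
    (ae_of_all _ fun x s _ => h s x)).2

/-- The derivative of `f` along the linear vector field `A`. -/
def derivAlong {N : ℕ} (A : E N →L[ℝ] E N) (f : E N → ℝ) (x : E N) : ℝ := fderiv ℝ f x (A x)

/-- The flow of a skew-symmetric linear field consists of isometries. -/
lemma norm_exp_smul_apply {N : ℕ} {A : E N →L[ℝ] E N} (hA : ∀ x, inner ℝ (A x) x = 0)
    (θ : ℝ) (x : E N) : ‖NormedSpace.exp (θ • A) x‖ = ‖x‖ := by
  have hd : ∀ t : ℝ, HasDerivAt (fun u : ℝ => NormedSpace.exp (u • A) x)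
      (A (NormedSpace.exp (t • A) x)) t := fun t => by
    have h := (hasDerivAt_exp_smul_const' A t)
    exact h.clm_apply (hasDerivAt_const t x) |>.congr_deriv (by simp)
  have hn : ∀ t : ℝ, HasDerivAt (fun u : ℝ => ‖NormedSpace.exp (u • A) x‖ ^ 2) 0 t := fun t => by
    refine (hd t).norm_sq.congr_deriv ?_
    rw [real_inner_comm, hA, mul_zero]
  have h := is_const_of_deriv_eq_zero (fun t => (hn t).differentiableAt)
    (fun t => (hn t).deriv) θ 0
  rw [zero_smul ℝ A, NormedSpace.exp_zero, one_apply_eq_self] at h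
  exact (pow_left_inj₀ (norm_nonneg _) (norm_nonneg _) two_ne_zero).1 h

/-- Derivatives along rotations have mean zero on the sphere. -/
lemma integral_derivAlong_eq_zero {N : ℕ} {A : E N →L[ℝ] E N} (hA : ∀ x, inner ℝ (A x) x = 0)
    {f : E N → ℝ} (hf : ContDiffOn ℝ 1 f {0}ᶜ) :
    ∫ ω : Sph N, derivAlong A f ω ∂sphMeasure N = 0 := by
  have hopen : IsOpen ({0}ᶜ : Set (E N)) := isOpen_compl_singleton
  -- The integral of `f` composed with the isometry `R θ` does not depend on `θ`; its derivative at
  -- `θ = 0` is the integral in question.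
  let R : ℝ → E N →L[ℝ] E N := fun θ => NormedSpace.exp (θ • A)
  have hRn : ∀ θ x, ‖R θ x‖ = ‖x‖ := norm_exp_smul_apply hA
  have hR0 : ∀ θ (ω : Sph N), R θ ω ≠ 0 := fun θ ω => by
    rw [← norm_ne_zero_iff, hRn, norm_sphere]; exact one_ne_zero
  have hRd : ∀ (x : E N) (t : ℝ), HasDerivAt (fun u : ℝ => R u x) (A (R t x)) t := fun x t =>
    ((hasDerivAt_exp_smul_const' A t).clm_apply (hasDerivAt_const t x)).congr_deriv (by simp [R])
  have hRc : Continuous R := continuous_iff_continuousAt.2 fun t =>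
    (hasDerivAt_exp_smul_const' A t).continuousAt
  have hRω : Continuous (fun z : ℝ × Sph N => R z.1 z.2) :=
    (hRc.comp continuous_fst).clm_apply (continuous_subtype_val.comp continuous_snd)
  have hfd : ∀ x ≠ 0, HasFDerivAt f (fderiv ℝ f x) x := fun x hx =>
    ((hf.differentiableOn one_ne_zero).differentiableAt (hopen.mem_nhds hx)).hasFDerivAt
  have hfc : ContinuousOn (fderiv ℝ f) {0}ᶜ := hf.continuousOn_fderiv_of_isOpen hopen le_rfl
  have hder : HasDerivAt (fun θ => ∫ ω : Sph N, f (R θ ω) ∂sphMeasure N)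
      (∫ ω : Sph N, fderiv ℝ f (R 0 ω) (A (R 0 ω)) ∂sphMeasure N) 0 := by
    refine hasDerivAt_integral_of_continuous (F := fun θ (ω : Sph N) => f (R θ ω))
      (F' := fun θ (ω : Sph N) => fderiv ℝ f (R θ ω) (A (R θ ω))) (fun θ => ?_) ?_ (fun θ ω => ?_) 0
    · exact hf.continuousOn.comp_continuous
        ((R θ).continuous.comp continuous_subtype_val) (hR0 θ)
    · exact (hfc.comp_continuous hRω fun z => hR0 z.1 z.2).clm_apply (A.continuous.comp hRω)
    · exact (hfd _ (hR0 θ ω)).comp_hasDerivAt θ (hRd ω θ)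
  have hconst : ∀ θ, ∫ ω : Sph N, f (R θ ω) ∂sphMeasure N = ∫ ω : Sph N, f ω ∂sphMeasure N := by
    intro θ
    let L : E N →ₗᵢ[ℝ] E N := ⟨(R θ).toLinearMap, hRn θ⟩
    exact integral_sphere_comp_isometry (L.toLinearIsometryEquiv rfl) hf.continuousOn
  simp only [hconst] at hder
  have h := hder.unique (hasDerivAt_const 0 _)
  have hR1 : R 0 = 1 := by simp only [R]; rw [zero_smul ℝ A, NormedSpace.exp_zero]
  simpa [hR1, derivAlong] using h

lemma contDiffOn_derivAlong {N : ℕ} (A : E N →L[ℝ] E N) {f : E N → ℝ} {n m : WithTop ℕ∞}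
    (hf : ContDiffOn ℝ n f {0}ᶜ) (hm : m + 1 ≤ n) : ContDiffOn ℝ m (derivAlong A f) {0}ᶜ :=
  (hf.fderiv_of_isOpen isOpen_compl_singleton hm).clm_apply A.contDiff.contDiffOn

lemma continuous_sphere_of_contDiffOn {N : ℕ} {f : E N → ℝ} {n : WithTop ℕ∞}
    (hf : ContDiffOn ℝ n f {0}ᶜ) : Continuous (fun ω : Sph N => f ω) :=
  hf.continuousOn.comp_continuous continuous_subtype_val sphere_ne_zero

lemma derivAlong_mul {N : ℕ} (A : E N →L[ℝ] E N) {f g : E N → ℝ} {n m : WithTop ℕ∞}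
    (hf : ContDiffOn ℝ n f {0}ᶜ) (hg : ContDiffOn ℝ m g {0}ᶜ) (hn : n ≠ 0) (hm : m ≠ 0)
    {x : E N} (hx : x ≠ 0) :
    derivAlong A (fun y => f y * g y) x = derivAlong A f x * g x + f x * derivAlong A g x := by
  have hopen : IsOpen ({0}ᶜ : Set (E N)) := isOpen_compl_singleton
  have h1 := (hf.differentiableOn hn).differentiableAt (hopen.mem_nhds hx)
  have h2 := (hg.differentiableOn hm).differentiableAt (hopen.mem_nhds hx)
  simp only [derivAlong]
  rw [fderiv_fun_mul h1 h2]
  simp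
  ring

/-- Integration by parts on the sphere. -/
lemma integral_derivAlong_mul {N : ℕ} {A : E N →L[ℝ] E N} (hA : ∀ x, inner ℝ (A x) x = 0)
    {f g : E N → ℝ} (hf : ContDiffOn ℝ 1 f {0}ᶜ) (hg : ContDiffOn ℝ 1 g {0}ᶜ) :
    ∫ ω : Sph N, derivAlong A f ω * g ω ∂sphMeasure N
      = - ∫ ω : Sph N, f ω * derivAlong A g ω ∂sphMeasure N := by
  have h := integral_derivAlong_eq_zero hA (hf.mul hg)
  have h' : ∀ ω : Sph N, derivAlong A (fun y => f y * g y) ω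
      = derivAlong A f ω * g ω + f ω * derivAlong A g ω := fun ω =>
    derivAlong_mul A hf hg one_ne_zero one_ne_zero (sphere_ne_zero ω)
  simp only [h'] at h
  have c1 := continuous_sphere_of_contDiffOn hf
  have c2 := continuous_sphere_of_contDiffOn hg
  have c3 := continuous_sphere_of_contDiffOn (contDiffOn_derivAlong A hf (m := 0) (by simp))
  have c4 := continuous_sphere_of_contDiffOn (contDiffOn_derivAlong A hg (m := 0) (by simp))
  have i1 : Integrable (fun ω : Sph N => derivAlong A f ω * g ω) (sphMeasure N) :=
    integrable_of_continuous_sphere (c3.mul c2)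
  have i2 : Integrable (fun ω : Sph N => f ω * derivAlong A g ω) (sphMeasure N) :=
    integrable_of_continuous_sphere (c1.mul c4)
  rw [integral_add i1 i2] at h
  linarith

lemma integral_derivAlong_derivAlong_mul {N : ℕ} {A : E N →L[ℝ] E N}
    (hA : ∀ x, inner ℝ (A x) x = 0)
    {f g : E N → ℝ} (hf : ContDiffOn ℝ 2 f {0}ᶜ) (hg : ContDiffOn ℝ 2 g {0}ᶜ) :
    ∫ ω : Sph N, derivAlong A (derivAlong A f) ω * g ω ∂sphMeasure N
      = ∫ ω : Sph N, f ω * derivAlong A (derivAlong A g) ω ∂sphMeasure N := by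
  have h2 : (1 : WithTop ℕ∞) + 1 ≤ 2 := by norm_num
  have h1 : (1 : WithTop ℕ∞) ≤ 2 := by norm_num
  rw [integral_derivAlong_mul hA (contDiffOn_derivAlong A hf h2) (hg.of_le h1),
    integral_derivAlong_mul hA (hf.of_le h1) (contDiffOn_derivAlong A hg h2), neg_neg]

/-! ### The spherical Laplacian and its action on powers of linear functions. -/

/-- The infinitesimal rotation in the plane of the `i`-th and `j`-th coordinates. -/
def rotGen {N : ℕ} (i j : Fin N) : E N →L[ℝ] E N :=
  (EuclideanSpace.proj i : E N →L[ℝ] ℝ).smulRight (EuclideanSpace.single j 1)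
    - (EuclideanSpace.proj j : E N →L[ℝ] ℝ).smulRight (EuclideanSpace.single i 1)

lemma rotGen_apply {N : ℕ} (i j : Fin N) (x : E N) :
    rotGen i j x = x i • EuclideanSpace.single j (1 : ℝ) - x j • EuclideanSpace.single i 1 := by
  simp [rotGen]

lemma inner_rotGen_self {N : ℕ} (i j : Fin N) (x : E N) : inner ℝ (rotGen i j x) x = 0 := by
  rw [rotGen_apply, inner_sub_left, inner_smul_left, inner_smul_left,
    EuclideanSpace.inner_single_left, EuclideanSpace.inner_single_left]
  simp
  ring

/-- The Laplace–Beltrami operator of the spheres, as a sum of squares of rotations. -/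
def sphLaplacian {N : ℕ} (f : E N → ℝ) (x : E N) : ℝ :=
  2⁻¹ * ∑ i, ∑ j, derivAlong (rotGen i j) (derivAlong (rotGen i j) f) x

lemma derivAlong_derivAlong {N : ℕ} (A : E N →L[ℝ] E N) {f : E N → ℝ}
    (hf : ContDiffOn ℝ 2 f {0}ᶜ) {x : E N} (hx : x ≠ 0) :
    derivAlong A (derivAlong A f) x
      = fderiv ℝ (fderiv ℝ f) x (A x) (A x) + fderiv ℝ f x (A (A x)) := by
  have hopen : IsOpen ({0}ᶜ : Set (E N)) := isOpen_compl_singleton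
  have h1 := ((hf.fderiv_of_isOpen hopen (m := 1) (by norm_num)).differentiableOn
    one_ne_zero).differentiableAt (hopen.mem_nhds hx)
  have : fderiv ℝ (derivAlong A f) x = fderiv ℝ (fun y => fderiv ℝ f y (A y)) x := rfl
  rw [derivAlong, this, fderiv_clm_apply h1 A.differentiableAt]
  simp [add_comm]

lemma eq_sum_single {N : ℕ} (x : E N) : x = ∑ i, x i • EuclideanSpace.single i (1 : ℝ) := by
  have h := (EuclideanSpace.basisFun (Fin N) ℝ).sum_repr x
  simpa using h.symm

lemma sum_apply_single {N : ℕ} (L : E N →L[ℝ] ℝ) (x : E N) :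
    ∑ i, x i * L (EuclideanSpace.single i 1) = L x := by
  conv_rhs => rw [eq_sum_single x]
  simp

lemma sum_sum_apply_single {N : ℕ} (H : E N →L[ℝ] E N →L[ℝ] ℝ) (x : E N) :
    ∑ i, ∑ j, x i * x j * H (EuclideanSpace.single i 1) (EuclideanSpace.single j 1) = H x x := by
  have h1 : ∀ i, ∑ j, x i * x j * H (EuclideanSpace.single i 1) (EuclideanSpace.single j 1)
      = x i * H (EuclideanSpace.single i 1) x := fun i => by
    rw [← sum_apply_single (H (EuclideanSpace.single i 1)) x, Finset.mul_sum]
    exact Finset.sum_congr rfl fun j _ => by ring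
  simp only [h1]
  exact sum_apply_single (H.flip x) x

/-- The spherical Laplacian in Cartesian coordinates. -/
lemma sphLaplacian_eq {N : ℕ} {f : E N → ℝ} (hf : ContDiffOn ℝ 2 f {0}ᶜ) {x : E N} (hx : x ≠ 0) :
    sphLaplacian f x = ‖x‖ ^ 2 * ∑ i, fderiv ℝ (fderiv ℝ f) x (EuclideanSpace.single i 1)
        (EuclideanSpace.single i 1)
      - fderiv ℝ (fderiv ℝ f) x x x - ((N : ℝ) - 1) * fderiv ℝ f x x := by
  set H := fderiv ℝ (fderiv ℝ f) x
  set D := fderiv ℝ f x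
  set b : Fin N → E N := fun i => EuclideanSpace.single i 1 with hb
  -- The field with `i = j` is zero, and the `if` term corrects the general formula there. In the
  -- sum it turns the coefficient `N` of the first-order term into `N - 1`.
  have hterm : ∀ i j, derivAlong (rotGen i j) (derivAlong (rotGen i j) f) x
      = x i ^ 2 * H (b j) (b j) + x j ^ 2 * H (b i) (b i) - x i * x j * H (b i) (b j)
        - x j * x i * H (b j) (b i)
        - (x i * D (b i) + x j * D (b j))
        + (if i = j then 2 * (x i * D (b i)) else 0) := by
    intro i j
    rw [derivAlong_derivAlong _ hf hx]
    have h1 : rotGen i j x = x i • b j - x j • b i := rotGen_apply i j x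
    have h2 : rotGen i j (rotGen i j x)
        = (if i = j then 2 * x i else 0) • b i - x i • b i - x j • b j := by
      rw [rotGen_apply i j (rotGen i j x), h1]
      by_cases hij : i = j
      · subst hij
        simp only [if_true, hb]
        simp
        module
      · have hji : j ≠ i := fun h => hij h.symm
        simp [hb, hij, hji]
        module
    rw [h2, h1]
    simp only [map_sub, map_smul, sub_apply, smul_apply,
      smul_eq_mul]
    split_ifs <;> ring
  have hn : ∑ i, x i ^ 2 = ‖x‖ ^ 2 := (EuclideanSpace.real_norm_sq_eq x).symm
  have s1 : ∑ i, ∑ j, x i ^ 2 * H (b j) (b j) = ‖x‖ ^ 2 * ∑ i, H (b i) (b i) := by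
    rw [← hn, Finset.sum_mul_sum]
  have s2 : ∑ i, ∑ j, x j ^ 2 * H (b i) (b i) = ‖x‖ ^ 2 * ∑ i, H (b i) (b i) := by
    rw [Finset.sum_comm, s1]
  have s3 : ∑ i, ∑ j, x i * x j * H (b i) (b j) = H x x := sum_sum_apply_single H x
  have s4 : ∑ i, ∑ j, x j * x i * H (b j) (b i) = H x x := by rw [Finset.sum_comm, s3]
  have s5 : ∑ i, x i * D (b i) = D x := sum_apply_single D x
  change _ = ‖x‖ ^ 2 * ∑ i, H (b i) (b i) - _ - _
  rw [sphLaplacian]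
  simp only [hterm, Finset.sum_add_distrib, Finset.sum_sub_distrib, s1, s2, s3, s4, s5,
    Finset.sum_const, Finset.card_univ, Fintype.card_fin, Finset.sum_ite_eq, Finset.mem_univ,
    if_true, nsmul_eq_mul]
  simp only [← Finset.mul_sum, s5]
  ring

/-- Rotation derivatives are skew-adjoint, so their squares are self-adjoint, and so is the sum of
these. -/
lemma integral_sphLaplacian_mul {N : ℕ} {f g : E N → ℝ} (hf : ContDiffOn ℝ 2 f {0}ᶜ)
    (hg : ContDiffOn ℝ 2 g {0}ᶜ) :
    ∫ ω : Sph N, sphLaplacian f ω * g ω ∂sphMeasure N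
      = ∫ ω : Sph N, f ω * sphLaplacian g ω ∂sphMeasure N := by
  have hc : ∀ {h : E N → ℝ}, ContDiffOn ℝ 2 h {0}ᶜ → ∀ i j : Fin N,
      Continuous fun ω : Sph N => derivAlong (rotGen i j) (derivAlong (rotGen i j) h) ω :=
    fun {h} hh i j => continuous_sphere_of_contDiffOn (contDiffOn_derivAlong _
      (contDiffOn_derivAlong _ hh (m := 1) (by norm_num)) (m := 0) (by simp))
  have c1 := continuous_sphere_of_contDiffOn hf
  have c2 := continuous_sphere_of_contDiffOn hg
  have e1 : ∀ ω : Sph N, sphLaplacian f ω * g ω = 2⁻¹ * ∑ i, ∑ j,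
      derivAlong (rotGen i j) (derivAlong (rotGen i j) f) ω * g ω := fun ω => by
    simp only [sphLaplacian, ← Finset.sum_mul]; ring
  have e2 : ∀ ω : Sph N, f ω * sphLaplacian g ω = 2⁻¹ * ∑ i, ∑ j,
      f ω * derivAlong (rotGen i j) (derivAlong (rotGen i j) g) ω := fun ω => by
    simp only [sphLaplacian, ← Finset.mul_sum]; ring
  simp only [e1, e2, integral_const_mul]
  congr 1
  have i1 : ∀ i j : Fin N, Integrable (fun ω : Sph N =>
      derivAlong (rotGen i j) (derivAlong (rotGen i j) f) ω * g ω) (sphMeasure N) :=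
    fun i j => integrable_of_continuous_sphere ((hc hf i j).mul c2)
  have i2 : ∀ i j : Fin N, Integrable (fun ω : Sph N =>
      f ω * derivAlong (rotGen i j) (derivAlong (rotGen i j) g) ω) (sphMeasure N) :=
    fun i j => integrable_of_continuous_sphere (c1.mul (hc hg i j))
  rw [integral_finsetSum _ fun i _ => integrable_finsetSum _ fun j _ => i1 i j,
    integral_finsetSum _ fun i _ => integrable_finsetSum _ fun j _ => i2 i j]
  refine Finset.sum_congr rfl fun i _ => ?_
  rw [integral_finsetSum _ fun j _ => i1 i j, integral_finsetSum _ fun j _ => i2 i j]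
  exact Finset.sum_congr rfl fun j _ =>
    integral_derivAlong_derivAlong_mul (inner_rotGen_self i j) hf hg

lemma fderiv_inner_pow {N : ℕ} (a : E N) (k : ℕ) :
    fderiv ℝ (fun x : E N => inner ℝ a x ^ k)
      = fun x => ((k : ℝ) * inner ℝ a x ^ (k - 1)) • innerSL ℝ a := by
  ext1 x
  have h : HasFDerivAt (fun x : E N => inner ℝ a x) (innerSL ℝ a) x := (innerSL ℝ a).hasFDerivAt
  exact ((h.pow k).congr_fderiv (by ext v; simp)).fderiv

lemma contDiff_inner_pow {N : ℕ} (a : E N) (k : ℕ) {n : WithTop ℕ∞} :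
    ContDiff ℝ n (fun x : E N => inner ℝ a x ^ k) :=
  ((innerSL ℝ a).contDiff (n := n)).pow k

/-- This triangular action replaces the spectral theory of the sphere. The truncated exponent `k -
2` is harmless for `k < 2`, where the factor `k (k - 1)` is zero. -/
lemma sphLaplacian_inner_pow {N : ℕ} (a : E N) (k : ℕ) (ω : Sph N) :
    sphLaplacian (fun x : E N => inner ℝ a x ^ k) ω
      = (k : ℝ) * (k - 1) * ‖a‖ ^ 2 * inner ℝ a (ω : E N) ^ (k - 2)
        - (k : ℝ) * (k + N - 2) * inner ℝ a (ω : E N) ^ k := by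
  rw [sphLaplacian_eq (contDiff_inner_pow a k).contDiffOn (sphere_ne_zero ω), norm_sphere]
  have h2 : ∀ u v : E N, fderiv ℝ (fderiv ℝ (fun x : E N => inner ℝ a x ^ k)) ω u v
      = (k : ℝ) * (k - 1) * inner ℝ a (ω : E N) ^ (k - 2) * inner ℝ a u * inner ℝ a v := by
    intro u v
    have hd : HasFDerivAt (fun x : E N => inner ℝ a x ^ (k - 1))
        ((((k - 1 : ℕ) : ℝ) * inner ℝ a (ω : E N) ^ (k - 1 - 1)) • innerSL ℝ a) (ω : E N) := by
      have := (contDiff_inner_pow a (k - 1) (n := 1)).differentiable one_ne_zero (ω : E N)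
      rw [← congrFun (fderiv_inner_pow a (k - 1)) (ω : E N)]
      exact this.hasFDerivAt
    rw [fderiv_inner_pow, ((hd.const_mul (k : ℝ)).smul_const (innerSL ℝ a)).fderiv]
    simp only [ContinuousLinearMap.smulRight_apply, smul_apply, smul_eq_mul,
      innerSL_apply_apply]
    rcases k with _ | k
    · simp
    · simp only [Nat.add_sub_cancel, Nat.cast_add, Nat.cast_one, add_sub_cancel_right]
      rw [show k + 1 - 2 = k - 1 by omega]
      ring
  have hs : ∑ i, inner ℝ a (EuclideanSpace.single i (1 : ℝ)) *
      inner ℝ a (EuclideanSpace.single i (1 : ℝ)) = ‖a‖ ^ 2 := by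
    rw [EuclideanSpace.real_norm_sq_eq]
    exact Finset.sum_congr rfl fun i _ => by
      rw [EuclideanSpace.inner_single_right]; simp [sq]
  simp only [h2, mul_assoc]
  simp only [← Finset.mul_sum, hs]
  rw [fderiv_inner_pow]
  simp only [smul_apply, smul_eq_mul, innerSL_apply_apply]
  rcases k with _ | _ | k
  · simp
  · simp
    left; ring
  · simp only [Nat.add_sub_cancel, Nat.cast_add, Nat.cast_one]
    rw [show k + 1 + 1 - 2 = k by omega]
    ring

/-- Moments of the spherical Laplacian. -/
lemma integral_sphLaplacian_mul_inner_pow {N : ℕ} {f : E N → ℝ} (hf : ContDiffOn ℝ 2 f {0}ᶜ)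
    (a : E N) (k : ℕ) :
    ∫ ω : Sph N, sphLaplacian f ω * inner ℝ a (ω : E N) ^ k ∂sphMeasure N
      = (k : ℝ) * (k - 1) * ‖a‖ ^ 2 *
          ∫ ω : Sph N, f ω * inner ℝ a (ω : E N) ^ (k - 2) ∂sphMeasure N
        - (k : ℝ) * (k + N - 2) * ∫ ω : Sph N, f ω * inner ℝ a (ω : E N) ^ k ∂sphMeasure N := by
  have hc : ∀ m : ℕ, Continuous fun ω : Sph N => f ω * inner ℝ a (ω : E N) ^ m := fun m =>
    (continuous_sphere_of_contDiffOn hf).mul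
      ((contDiff_inner_pow a m (n := 0)).continuous.comp continuous_subtype_val)
  rw [integral_sphLaplacian_mul hf (contDiff_inner_pow a k).contDiffOn,
    ← integral_const_mul, ← integral_const_mul,
    ← integral_sub ((integrable_of_continuous_sphere (hc _)).const_mul _)
      ((integrable_of_continuous_sphere (hc _)).const_mul _)]
  refine integral_congr_ae (ae_of_all _ fun ω => ?_)
  simp only [sphLaplacian_inner_pow]
  ring

/-! ### Completeness of the moments. -/

/-- A continuous function on the sphere whose moments all vanish is zero. -/
lemma eq_zero_of_moments {N : ℕ} {F : Sph N → ℝ} (hF : Continuous F)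
    (h : ∀ (a : E N) (k : ℕ), ∫ ω : Sph N, F ω * inner ℝ a (ω : E N) ^ k ∂sphMeasure N = 0) :
    F = 0 := by
  -- Summing the exponential series turns vanishing moments into orthogonality to `exp ⟨a, ω⟩`.
  -- Unlike powers with varying `a`, these exponentials are closed under products.
  let ex : E N → C(Sph N, ℝ) := fun a => ⟨fun ω => exp (inner ℝ a (ω : E N)), by fun_prop⟩
  have hex : ∀ a, ∫ ω : Sph N, F ω * ex a ω ∂sphMeasure N = 0 := by
    intro a
    have hc : ∀ k : ℕ, Continuous fun ω : Sph N =>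
        F ω * (inner ℝ a (ω : E N) ^ k / (k.factorial : ℝ)) := fun k => by fun_prop
    obtain ⟨C, hC⟩ := isCompact_univ.exists_bound_of_continuousOn hF.continuousOn
    have hsum := hasSum_integral_of_summable_integral_norm (μ := sphMeasure N)
      (F := fun (k : ℕ) (ω : Sph N) => F ω * (inner ℝ a (ω : E N) ^ k / (k.factorial : ℝ)))
      (fun k => integrable_of_continuous_sphere (hc k)) (by
        refine Summable.of_nonneg_of_le (fun k => integral_nonneg fun ω => norm_nonneg _)
          (fun k => ?_) ((Real.summable_pow_div_factorial ‖a‖).mul_left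
            (C * (sphMeasure N).real Set.univ))
        have hb : ∀ ω : Sph N, ‖F ω * (inner ℝ a (ω : E N) ^ k / (k.factorial : ℝ))‖
            ≤ C * (‖a‖ ^ k / k.factorial) := fun ω => by
          rw [norm_mul, norm_div, norm_pow, Real.norm_natCast]
          have h1 := hC ω (Set.mem_univ _)
          have h2 : ‖inner ℝ a (ω : E N)‖ ≤ ‖a‖ := by
            have := norm_inner_le_norm (𝕜 := ℝ) a (ω : E N)
            rwa [norm_sphere, mul_one] at this
          have h3 : 0 ≤ C := (norm_nonneg _).trans h1
          gcongr
        calc ∫ ω : Sph N, ‖F ω * (inner ℝ a (ω : E N) ^ k / (k.factorial : ℝ))‖ ∂sphMeasure N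
            ≤ ∫ ω : Sph N, C * (‖a‖ ^ k / k.factorial) ∂sphMeasure N :=
              integral_mono (integrable_of_continuous_sphere (hc k).norm)
                (integrable_const _) hb
          _ = C * (sphMeasure N).real Set.univ * (‖a‖ ^ k / k.factorial) := by
              rw [integral_const, smul_eq_mul]; ring)
    have hz : ∀ k : ℕ, ∫ ω : Sph N,
        F ω * (inner ℝ a (ω : E N) ^ k / (k.factorial : ℝ)) ∂sphMeasure N = 0 := fun k => by
      have : ∀ ω : Sph N, F ω * (inner ℝ a (ω : E N) ^ k / (k.factorial : ℝ))
          = (F ω * inner ℝ a (ω : E N) ^ k) * (k.factorial : ℝ)⁻¹ := fun ω => by ring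
      simp only [this]
      rw [integral_mul_const, h a k, zero_mul]
    simp only [hz] at hsum
    have h0 := hsum.unique hasSum_zero
    rw [← h0]
    refine integral_congr_ae (ae_of_all _ fun ω => ?_)
    have he := (NormedSpace.expSeries_div_hasSum_exp (inner ℝ a (ω : E N))).mul_left (F ω)
    rw [← Real.exp_eq_exp_ℝ] at he
    exact he.tsum_eq.symm
  -- As `S` is a monoid, the algebra it generates is just its linear span, so orthogonality passes
  -- to the whole algebra.
  let S : Submonoid C(Sph N, ℝ) :=
    { carrier := Set.range ex
      one_mem' := ⟨0, by ext ω; simp [ex]⟩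
      mul_mem' := by
        rintro _ _ ⟨a, rfl⟩ ⟨b, rfl⟩
        exact ⟨a + b, by ext ω; simp [ex, inner_add_left, exp_add]⟩ }
  let A : Subalgebra ℝ C(Sph N, ℝ) := Algebra.adjoin ℝ (S : Set C(Sph N, ℝ))
  have hA : ∀ g ∈ A, ∫ ω : Sph N, F ω * g ω ∂sphMeasure N = 0 := by
    intro g hg
    have hg' : g ∈ Submodule.span ℝ (S : Set C(Sph N, ℝ)) := by
      have h1 := Algebra.adjoin_eq_span ℝ (S : Set C(Sph N, ℝ))
      rw [Submonoid.closure_eq] at h1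
      rw [← h1]
      exact hg
    clear hg
    have hi : ∀ g : C(Sph N, ℝ), Integrable (fun ω => F ω * g ω) (sphMeasure N) := fun g =>
      integrable_of_continuous_sphere (by fun_prop)
    induction hg' using Submodule.span_induction with
    | mem x hx => obtain ⟨a, rfl⟩ := hx; exact hex a
    | zero => simp
    | add x y _ _ hx hy =>
      simp only [ContinuousMap.add_apply, mul_add]
      rw [integral_add (hi x) (hi y), hx, hy, add_zero]
    | smul c x _ hx =>
      simp only [ContinuousMap.smul_apply, smul_eq_mul, mul_left_comm _ c]
      rw [integral_const_mul, hx, mul_zero]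
  have hsep : A.SeparatesPoints := by
    intro x y hxy
    by_contra! hne
    have h1 : ∀ a, inner ℝ a (x : E N) = inner ℝ a (y : E N) := fun a => by
      have := hne (ex a) ⟨ex a, Algebra.subset_adjoin ⟨a, rfl⟩, rfl⟩
      exact exp_injective this
    exact hxy (Subtype.ext (ext_inner_left ℝ h1))
  -- Stone–Weierstrass: with `g` in the algebra within `ε` of `F`, the integral of `F²` equals that
  -- of `F (F - g)`, hence is at most `ε K`.
  have hsq : ∫ ω : Sph N, F ω * F ω ∂sphMeasure N = 0 := by
    set K := ∫ ω : Sph N, |F ω| ∂sphMeasure N with hK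
    have hK0 : 0 ≤ K := integral_nonneg fun ω => abs_nonneg _
    have hle : ∀ ε > 0, |∫ ω : Sph N, F ω * F ω ∂sphMeasure N| ≤ ε * K := by
      intro ε hε
      obtain ⟨⟨g, hg⟩, hgF⟩ :=
        ContinuousMap.exists_mem_subalgebra_near_continuous_of_separatesPoints A hsep F hF ε hε
      have hsub : ∫ ω : Sph N, F ω * F ω ∂sphMeasure N
          = ∫ ω : Sph N, F ω * (F ω - g ω) ∂sphMeasure N := by
        simp only [mul_sub]
        rw [integral_sub (integrable_of_continuous_sphere (by fun_prop))
          (integrable_of_continuous_sphere (by fun_prop)), hA g hg, sub_zero]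
      rw [hsub, hK, ← integral_const_mul]
      refine abs_integral_le_integral_abs.trans (integral_mono
        (integrable_of_continuous_sphere (by fun_prop))
        (integrable_of_continuous_sphere (by fun_prop)) fun ω => ?_)
      have := (hgF ω).le
      rw [Real.norm_eq_abs, abs_sub_comm] at this
      simp only [abs_mul]
      rw [mul_comm]
      gcongr
    by_contra hne
    have hpos := abs_pos.2 hne
    have := hle (|∫ ω : Sph N, F ω * F ω ∂sphMeasure N| / (2 * (K + 1))) (by positivity)
    have h2 : |∫ ω : Sph N, F ω * F ω ∂sphMeasure N| / (2 * (K + 1)) * K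
        < |∫ ω : Sph N, F ω * F ω ∂sphMeasure N| := by
      rw [div_mul_eq_mul_div, div_lt_iff₀ (by positivity)]
      nlinarith
    linarith
  have h0 := (integral_eq_zero_iff_of_nonneg (fun ω => mul_self_nonneg (F ω))
    (integrable_of_continuous_sphere (hF.mul hF))).1 hsq
  have h1 := (Continuous.ae_eq_iff_eq (sphMeasure N) (hF.mul hF) continuous_zero).1 h0
  ext ω
  exact mul_self_eq_zero.1 (congrFun h1 ω)

/-! ### The bubble and the linearized operator in polar form. -/

/-- The conjugate exponent `N / (N - 1)`. -/
def expo (N : ℕ) : ℝ := (N : ℝ) / ((N : ℝ) - 1)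

lemma one_lt_expo {N : ℕ} (hN : 2 ≤ N) : 1 < expo N := by
  have hN' : (2 : ℝ) ≤ N := by exact_mod_cast hN
  rw [expo, lt_div_iff₀ (by linarith)]
  linarith

lemma expo_pos {N : ℕ} (hN : 2 ≤ N) : 0 < expo N := zero_lt_one.trans (one_lt_expo hN)

lemma constC_pos {N : ℕ} (hN : 2 ≤ N) : 0 < constC N := by
  have hN' : (2 : ℝ) ≤ N := by exact_mod_cast hN
  have : (0 : ℝ) < (N : ℝ) - 1 := by linarith
  rw [constC]
  positivity

lemma one_add_norm_rpow_pos {N : ℕ} (x : E N) (q : ℝ) : 0 < 1 + ‖x‖ ^ q := by positivity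

lemma bubble_eq {N : ℕ} (hN : 2 ≤ N) (x : E N) :
    bubble N x = log (constC N) - N * log (1 + ‖x‖ ^ expo N) := by
  rw [bubble, log_div (constC_pos hN).ne' (pow_pos (one_add_norm_rpow_pos x _) N).ne', log_pow]
  rfl

/-- The origin is included because `p > 1` makes `|x| ^ p` differentiable there. -/
lemma hasGradientAt_bubble {N : ℕ} (hN : 2 ≤ N) (x : E N) :
    HasGradientAt (bubble N)
      (-(N * (expo N * ‖x‖ ^ (expo N - 2)) / (1 + ‖x‖ ^ expo N)) • x) x := by
  rw [hasGradientAt_iff_hasFDerivAt]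
  have h := ((((hasFDerivAt_norm_rpow x (one_lt_expo hN)).const_add 1).log
    (one_add_norm_rpow_pos x _).ne').const_mul (N : ℝ)).const_sub (log (constC N))
  refine (h.congr_of_eventuallyEq (Eventually.of_forall (bubble_eq hN))).congr_fderiv ?_
  ext v
  simp
  ring

lemma gradient_bubble {N : ℕ} (hN : 2 ≤ N) (x : E N) :
    gradient (bubble N) x = -(N * (expo N * ‖x‖ ^ (expo N - 2)) / (1 + ‖x‖ ^ expo N)) • x :=
  (hasGradientAt_bubble hN x).gradient

/-- `|∇U|` as a function of `|x|`. -/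
def gradNorm (N : ℕ) (r : ℝ) : ℝ := N * expo N * r ^ (expo N - 1) / (1 + r ^ expo N)

lemma gradNorm_pos {N : ℕ} (hN : 2 ≤ N) {r : ℝ} (hr : 0 < r) : 0 < gradNorm N r := by
  have := expo_pos hN
  have hN' : (0 : ℝ) < N := by positivity
  rw [gradNorm]
  positivity

lemma gradient_bubble_of_ne {N : ℕ} (hN : 2 ≤ N) {x : E N} (hx : x ≠ 0) :
    gradient (bubble N) x = -(gradNorm N ‖x‖ / ‖x‖) • x := by
  have hr : 0 < ‖x‖ := norm_pos_iff.2 hx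
  rw [gradient_bubble hN, gradNorm, show expo N - 2 = expo N - 1 - 1 by ring,
    rpow_sub_one hr.ne' (expo N - 1)]
  congr 2
  field_simp

lemma norm_gradient_bubble {N : ℕ} (hN : 2 ≤ N) {x : E N} (hx : x ≠ 0) :
    ‖gradient (bubble N) x‖ = gradNorm N ‖x‖ := by
  have hr : 0 < ‖x‖ := norm_pos_iff.2 hx
  rw [gradient_bubble_of_ne hN hx, norm_smul, norm_neg, norm_div, norm_norm, Real.norm_eq_abs,
    abs_of_pos (gradNorm_pos hN hr)]
  field_simp

/-- The radial variable `σ = r^p / (1 + r^p)`. -/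
def sigmaR (N : ℕ) (r : ℝ) : ℝ := r ^ expo N / (1 + r ^ expo N)

/-- The coefficient `|∇U|^(N-2)` as a function of `|x|`. -/
def coef (N : ℕ) (r : ℝ) : ℝ := gradNorm N r ^ ((N : ℝ) - 2)

lemma coef_pos {N : ℕ} (hN : 2 ≤ N) {r : ℝ} (hr : 0 < r) : 0 < coef N r :=
  rpow_pos_of_pos (gradNorm_pos hN hr) _

lemma hasDerivAt_gradNorm {N : ℕ} {r : ℝ} (hr : 0 < r) :
    HasDerivAt (gradNorm N) (gradNorm N r * (expo N - 1 - expo N * sigmaR N r) / r) r := by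
  have h1 := (Real.hasDerivAt_rpow_const (x := r) (p := expo N - 1) (Or.inl hr.ne')).const_mul
    (N * expo N)
  have h2 := (Real.hasDerivAt_rpow_const (x := r) (p := expo N) (Or.inl hr.ne')).const_add 1
  have hpos : 0 < 1 + r ^ expo N := by positivity
  refine (h1.div h2 hpos.ne').congr_deriv ?_
  rw [gradNorm, sigmaR, rpow_sub_one hr.ne' (expo N - 1), rpow_sub_one hr.ne' (expo N)]
  field_simp

lemma hasDerivAt_coef {N : ℕ} (hN : 2 ≤ N) {r : ℝ} (hr : 0 < r) :
    HasDerivAt (coef N)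
      (coef N r * (((N : ℝ) - 2) * (expo N - 1 - expo N * sigmaR N r)) / r) r := by
  have hg := gradNorm_pos hN hr
  have h := (hasDerivAt_gradNorm (N := N) hr).rpow_const (p := (N : ℝ) - 2) (Or.inl hg.ne')
  refine h.congr_deriv ?_
  rw [coef, rpow_sub_one hg.ne']
  field_simp

/-- Derivative of a radial function. -/
lemma hasFDerivAt_radial {N : ℕ} {h : ℝ → ℝ} {h' : ℝ} {x : E N} (hx : x ≠ 0)
    (hh : HasDerivAt h h' ‖x‖) :
    HasFDerivAt (fun y : E N => h ‖y‖) ((h' / ‖x‖) • innerSL ℝ x) x := by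
  have hr : 0 < ‖x‖ := norm_pos_iff.2 hx
  have h1 : HasFDerivAt (fun y : E N => ‖y‖ ^ 2) (2 • innerSL ℝ x) x := by
    refine (hasFDerivAt_id x).norm_sq.congr_fderiv ?_
    ext v; simp
  have h2 : HasFDerivAt (fun y : E N => ‖y‖) (‖x‖⁻¹ • innerSL ℝ x) x := by
    have h3 := h1.sqrt (by positivity)
    simp only [sqrt_sq (norm_nonneg _)] at h3
    refine h3.congr_fderiv ?_
    ext v
    simp
    field_simp
  refine (hh.comp_hasFDerivAt x h2).congr_fderiv ?_
  ext v
  simp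
  ring

lemma gradient_apply_coord {N : ℕ} (f : E N → ℝ) (x : E N) (i : Fin N) :
    (gradient f x) i = fderiv ℝ f x (EuclideanSpace.single i 1) := by
  rw [← inner_gradient_left, EuclideanSpace.inner_single_right]
  simp

lemma divergence_congr {N : ℕ} {V W : E N → E N} {x : E N} (h : V =ᶠ[𝓝 x] W) :
    divergence V x = divergence W x := by
  refine Finset.sum_congr rfl fun i _ => ?_
  have : (fun y => V y i) =ᶠ[𝓝 x] fun y => W y i := h.mono fun y hy => by simp only [hy]
  rw [partialDeriv, partialDeriv, this.fderiv_eq]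

lemma hasFDerivAt_fderiv {N : ℕ} {φ : E N → ℝ} (hφ : ContDiffOn ℝ 2 φ {0}ᶜ) {x : E N}
    (hx : x ≠ 0) : HasFDerivAt (fderiv ℝ φ) (fderiv ℝ (fderiv ℝ φ) x) x :=
  (((hφ.fderiv_of_isOpen isOpen_compl_singleton (m := 1) (by norm_num)).differentiableOn
    one_ne_zero).differentiableAt (isOpen_compl_singleton.mem_nhds hx)).hasFDerivAt

/-- Divergence of a radial multiple of a gradient. -/
lemma divergence_radial_smul_gradient {N : ℕ} {φ : E N → ℝ} (hφ : ContDiffOn ℝ 2 φ {0}ᶜ)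
    {h : ℝ → ℝ} {h' : ℝ} {x : E N} (hx : x ≠ 0) (hh : HasDerivAt h h' ‖x‖) :
    divergence (fun y => h ‖y‖ • gradient φ y) x
      = h ‖x‖ * ∑ i, fderiv ℝ (fderiv ℝ φ) x (EuclideanSpace.single i 1)
          (EuclideanSpace.single i 1) + h' / ‖x‖ * fderiv ℝ φ x x := by
  have hi : ∀ i, partialDeriv i (fun y => (h ‖y‖ • gradient φ y) i) x
      = h ‖x‖ * fderiv ℝ (fderiv ℝ φ) x (EuclideanSpace.single i 1) (EuclideanSpace.single i 1)
        + h' / ‖x‖ * (x i * fderiv ℝ φ x (EuclideanSpace.single i 1)) := fun i => by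
    have h1 := (hasFDerivAt_radial hx hh).mul ((hasFDerivAt_fderiv hφ hx).clm_apply
      (hasFDerivAt_const (EuclideanSpace.single i (1 : ℝ)) x))
    have h2 : (fun y => (h ‖y‖ • gradient φ y) i)
        = fun y => h ‖y‖ * fderiv ℝ φ y (EuclideanSpace.single i 1) := by
      ext y; simp [gradient_apply_coord]
    rw [partialDeriv, h2]
    erw [h1.fderiv]
    simp [EuclideanSpace.inner_single_right]
    ring
  simp only [divergence, hi, Finset.sum_add_distrib, ← Finset.mul_sum, sum_apply_single]

/-- Divergence of a radial multiple of the radial component of a gradient. -/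
lemma divergence_radial_smul_self {N : ℕ} {φ : E N → ℝ} (hφ : ContDiffOn ℝ 2 φ {0}ᶜ)
    {h : ℝ → ℝ} {h' : ℝ} {x : E N} (hx : x ≠ 0) (hh : HasDerivAt h h' ‖x‖) :
    divergence (fun y => (h ‖y‖ * fderiv ℝ φ y y) • y) x
      = N * (h ‖x‖ * fderiv ℝ φ x x) + h ‖x‖ * (fderiv ℝ (fderiv ℝ φ) x x x + fderiv ℝ φ x x)
        + h' * ‖x‖ * fderiv ℝ φ x x := by
  have hr : 0 < ‖x‖ := norm_pos_iff.2 hx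
  have h1 := (hasFDerivAt_radial hx hh).mul ((hasFDerivAt_fderiv hφ hx).clm_apply
    (hasFDerivAt_id x))
  set u : E N → ℝ := fun y => h ‖y‖ * fderiv ℝ φ y y with hu
  have hud : HasFDerivAt u (fderiv ℝ u x) x := h1.differentiableAt.hasFDerivAt
  have hi : ∀ i, partialDeriv i (fun y => (u y • y) i) x
      = u x + x i * fderiv ℝ u x (EuclideanSpace.single i 1) := fun i => by
    have h2 := hud.mul (EuclideanSpace.proj i : E N →L[ℝ] ℝ).hasFDerivAt
    have h3 : (fun y => (u y • y) i) = fun y => u y * y i := by ext y; simp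
    rw [partialDeriv, h3]
    erw [h2.fderiv]
    simp
  change divergence (fun y => u y • y) x = _
  simp only [divergence, hi, Finset.sum_add_distrib, sum_apply_single, Finset.sum_const,
    Finset.card_univ, Fintype.card_fin, nsmul_eq_mul]
  have h4 : fderiv ℝ u x x = h ‖x‖ * (fderiv ℝ (fderiv ℝ φ) x x x + fderiv ℝ φ x x)
        + h' * ‖x‖ * fderiv ℝ φ x x := by
    erw [h1.fderiv]
    simp
    field_simp
    ring
  rw [h4]
  ring

/-- The powers of `|x|` match because `(p - 1) (N - 2) + p = 2`, and the constants because `N ^ 2 /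
(N - 1) = N p`. -/
lemma exp_bubble_mul_sq {N : ℕ} (hN : 2 ≤ N) {x : E N} (hx : x ≠ 0) :
    exp (bubble N x) * ‖x‖ ^ 2
      = coef N ‖x‖ * ((N : ℝ) ^ 3 / (N - 1) * (sigmaR N ‖x‖ * (1 - sigmaR N ‖x‖))) := by
  have hr : 0 < ‖x‖ := norm_pos_iff.2 hx
  have hN' : (2 : ℝ) ≤ N := by exact_mod_cast hN
  have hN1 : (0 : ℝ) < (N : ℝ) - 1 := by linarith
  obtain ⟨n, rfl⟩ := Nat.exists_eq_add_of_le' hN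
  have hpos : 0 < 1 + ‖x‖ ^ expo (n + 2) := one_add_norm_rpow_pos x _
  have hC := constC_pos hN
  have e1 : exp (bubble (n + 2) x) = constC (n + 2) / (1 + ‖x‖ ^ expo (n + 2)) ^ (n + 2) := by
    rw [bubble]
    exact exp_log (div_pos hC (pow_pos hpos _))
  have e2 : coef (n + 2) ‖x‖ = gradNorm (n + 2) ‖x‖ ^ n := by
    rw [coef, ← rpow_natCast]
    congr 1
    push_cast; ring
  have e3 : (‖x‖ ^ (expo (n + 2) - 1)) ^ n * ‖x‖ ^ expo (n + 2) = ‖x‖ ^ 2 := by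
    rw [← rpow_natCast, ← rpow_natCast, ← rpow_mul hr.le, ← rpow_add hr]
    congr 1
    rw [expo]
    field_simp
    push_cast
    ring
  have e4 : (((n + 2 : ℕ) : ℝ) ^ 2 / (((n + 2 : ℕ) : ℝ) - 1)) = (n + 2 : ℕ) * expo (n + 2) := by
    rw [expo]; ring
  have e5 : ((n + 2 : ℕ) : ℝ) ^ 3 / (((n + 2 : ℕ) : ℝ) - 1)
      = (n + 2 : ℕ) * ((n + 2 : ℕ) * expo (n + 2)) := by
    rw [expo]; ring
  rw [e1, e2, ← e3, constC, e4, e5, gradNorm, sigmaR, show n + 2 - 1 = n + 1 by omega]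
  generalize ‖x‖ ^ expo (n + 2) = t at *
  generalize ‖x‖ ^ (expo (n + 2) - 1) = v at *
  have e6 : 1 - t / (1 + t) = 1 / (1 + t) := by field_simp; ring
  rw [e6, div_pow, mul_pow]
  field_simp
  ring

/-- The equation `L φ = 0` in terms of the radial derivatives and the spherical Laplacian. -/
lemma linearizedOp_mul_sq {N : ℕ} (hN : 2 ≤ N) {φ : E N → ℝ} (hφ : ContDiffOn ℝ 2 φ {0}ᶜ)
    {x : E N} (hx : x ≠ 0) :
    linearizedOp N φ x * ‖x‖ ^ 2 = coef N ‖x‖ *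
      (((N : ℝ) - 1) * (fderiv ℝ (fderiv ℝ φ) x x x + fderiv ℝ φ x x
          + ((N : ℝ) - 2) * (expo N * (1 - sigmaR N ‖x‖)) * fderiv ℝ φ x x)
        + sphLaplacian φ x
        + (N : ℝ) ^ 3 / (N - 1) * (sigmaR N ‖x‖ * (1 - sigmaR N ‖x‖)) * φ x) := by
  have hr : 0 < ‖x‖ := norm_pos_iff.2 hx
  have hev : ∀ᶠ y in 𝓝 x, y ≠ 0 := isOpen_compl_singleton.mem_nhds hx
  have d1 : divergence (fun y => ‖gradient (bubble N) y‖ ^ ((N : ℝ) - 2) • gradient φ y) x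
      = divergence (fun y => coef N ‖y‖ • gradient φ y) x :=
    divergence_congr (hev.mono fun y hy => by
      simp only [norm_gradient_bubble hN hy, coef])
  -- Since `∇U` is a radial multiple of `y`, this field is `(y ⬝ ∇φ) y` times the radial factor
  -- `coef / r ^ 2`.
  have d2 : divergence (fun y => (‖gradient (bubble N) y‖ ^ ((N : ℝ) - 4)
        * inner ℝ (gradient (bubble N) y) (gradient φ y)) • gradient (bubble N) y) x
      = divergence (fun y => ((fun r => coef N r / r ^ 2) ‖y‖ * fderiv ℝ φ y y) • y) x :=
    divergence_congr (hev.mono fun y hy => by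
      have hy' : 0 < ‖y‖ := norm_pos_iff.2 hy
      have hg := gradNorm_pos hN hy'
      have hc : coef N ‖y‖ = gradNorm N ‖y‖ ^ ((N : ℝ) - 4) * gradNorm N ‖y‖ ^ 2 := by
        rw [coef, ← rpow_natCast (gradNorm N ‖y‖) 2, ← rpow_add hg]
        congr 1
        push_cast; ring
      simp only
      rw [norm_gradient_bubble hN hy, gradient_bubble_of_ne hN hy, inner_smul_left,
        inner_gradient_right, smul_smul, hc]
      congr 1
      simp
      field_simp)
  have hd := hasDerivAt_coef hN hr
  have hd2 : HasDerivAt (fun r => coef N r / r ^ 2) _ ‖x‖ :=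
    hd.div (hasDerivAt_pow 2 ‖x‖) (by positivity)
  rw [linearizedOp, d1, d2, divergence_radial_smul_gradient hφ hx hd,
    divergence_radial_smul_self hφ hx hd2, sphLaplacian_eq hφ hx]
  have he := exp_bubble_mul_sq hN hx
  have key : ∀ A B C D : ℝ, (A + B + C * D) * ‖x‖ ^ 2
      = (A + B) * ‖x‖ ^ 2 + C * ‖x‖ ^ 2 * D := fun A B C D => by ring
  rw [key, he]
  field_simp
  ring

/-! ### The equation in the variables `(s, ω)`. -/

/-- The radius `e^(s/p)` corresponding to the logarithmic variable `s = p log r`. -/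
def radius (N : ℕ) (s : ℝ) : ℝ := exp (s / expo N)

lemma radius_pos (N : ℕ) (s : ℝ) : 0 < radius N s := exp_pos _

lemma radius_rpow {N : ℕ} (hN : 2 ≤ N) (s : ℝ) : radius N s ^ expo N = exp s := by
  have := (expo_pos hN).ne'
  rw [radius, ← exp_mul]
  congr 1
  field_simp

lemma sigmaR_radius {N : ℕ} (hN : 2 ≤ N) (s : ℝ) : sigmaR N (radius N s) = sigmoid s := by
  rw [sigmaR, radius_rpow hN, sigmoid_def, exp_neg]
  have := exp_pos s
  field_simp
  ring

lemma radius_smul_ne_zero {N : ℕ} (s : ℝ) (ω : Sph N) : radius N s • (ω : E N) ≠ 0 :=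
  smul_ne_zero (radius_pos N s).ne' (sphere_ne_zero ω)

lemma norm_radius_smul {N : ℕ} (s : ℝ) (ω : Sph N) : ‖radius N s • (ω : E N)‖ = radius N s := by
  rw [norm_smul, norm_sphere, mul_one, Real.norm_eq_abs, abs_of_pos (radius_pos N s)]

lemma hasDerivAt_radius_smul {N : ℕ} (s : ℝ) (x : E N) :
    HasDerivAt (fun s => radius N s • x) ((expo N)⁻¹ • (radius N s • x)) s := by
  have h := ((((hasDerivAt_id s).div_const (expo N)).exp).smul_const x)
  refine h.congr_deriv ?_
  rw [smul_smul]
  congr 1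
  simp [radius, mul_comm]

lemma continuous_radius_smul {N : ℕ} :
    Continuous (fun z : ℝ × Sph N => radius N z.1 • (z.2 : E N)) := by
  unfold radius
  fun_prop

lemma hasDerivAt_cyl {N : ℕ} {φ : E N → ℝ} (hφ : ContDiffOn ℝ 2 φ {0}ᶜ) (s : ℝ) (ω : Sph N) :
    HasDerivAt (fun s => φ (radius N s • (ω : E N)))
      ((expo N)⁻¹ * fderiv ℝ φ (radius N s • (ω : E N)) (radius N s • (ω : E N))) s := by
  have h := ((hφ.differentiableOn two_ne_zero).differentiableAt
    (isOpen_compl_singleton.mem_nhds (radius_smul_ne_zero s ω))).hasFDerivAt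
  refine (h.comp_hasDerivAt s (hasDerivAt_radius_smul s (ω : E N))).congr_deriv ?_
  rw [map_smul, smul_eq_mul]

lemma hasDerivAt_deriv_cyl {N : ℕ} {φ : E N → ℝ} (hφ : ContDiffOn ℝ 2 φ {0}ᶜ) (s : ℝ)
    (ω : Sph N) :
    HasDerivAt (fun s => (expo N)⁻¹ *
        fderiv ℝ φ (radius N s • (ω : E N)) (radius N s • (ω : E N)))
      ((expo N)⁻¹ ^ 2 * (fderiv ℝ (fderiv ℝ φ) (radius N s • (ω : E N)) (radius N s • (ω : E N))
          (radius N s • (ω : E N))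
        + fderiv ℝ φ (radius N s • (ω : E N)) (radius N s • (ω : E N)))) s := by
  have hy := hasDerivAt_radius_smul s (ω : E N)
  have h := (hasFDerivAt_fderiv hφ (radius_smul_ne_zero s ω)).comp_hasDerivAt s hy
  refine ((h.clm_apply hy).const_mul (expo N)⁻¹).congr_deriv ?_
  simp only [map_smul, smul_apply, smul_eq_mul, Function.comp]
  ring

/-- Linear vector fields commute with dilations. -/
lemma sphLaplacian_comp_smul {N : ℕ} (f : E N → ℝ) (t : ℝ) (x : E N) :
    sphLaplacian (fun y => f (t • y)) x = sphLaplacian f (t • x) := by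
  have h : ∀ (A : E N →L[ℝ] E N) (f : E N → ℝ),
      derivAlong A (fun y => f (t • y)) = fun y => derivAlong A f (t • y) := fun A f => by
    ext y
    simp only [derivAlong, fderiv_comp_smul, smul_apply, map_smul]
  simp only [sphLaplacian, h]

/-- The equation in the variables `(s, ω)`. -/
lemma cyl_equation {N : ℕ} (hN : 2 ≤ N) {φ : E N → ℝ} (hφ : ContDiffOn ℝ 2 φ {0}ᶜ)
    (hsol : ∀ x : E N, x ≠ 0 → linearizedOp N φ x = 0) (s : ℝ) (ω : Sph N) :
    (expo N)⁻¹ ^ 2 * (fderiv ℝ (fderiv ℝ φ) (radius N s • (ω : E N)) (radius N s • (ω : E N))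
          (radius N s • (ω : E N))
        + fderiv ℝ φ (radius N s • (ω : E N)) (radius N s • (ω : E N)))
      + ((N : ℝ) - 2) * (1 - sigmoid s) *
        ((expo N)⁻¹ * fderiv ℝ φ (radius N s • (ω : E N)) (radius N s • (ω : E N)))
      + N * (sigmoid s * (1 - sigmoid s)) * φ (radius N s • (ω : E N))
      = -(((N : ℝ) - 1) / N ^ 2) * sphLaplacian (fun y => φ (radius N s • y)) ω := by
  have hN' : (2 : ℝ) ≤ N := by exact_mod_cast hN
  have hN0 : (N : ℝ) ≠ 0 := by linarith
  have hN1 : (N : ℝ) - 1 ≠ 0 := by linarith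
  have hy := radius_smul_ne_zero s ω
  have h := linearizedOp_mul_sq hN hφ hy
  rw [hsol _ hy, zero_mul, norm_radius_smul, sigmaR_radius hN] at h
  have h' := (mul_eq_zero.1 h.symm).resolve_left (coef_pos hN (radius_pos N s)).ne'
  rw [sphLaplacian_comp_smul]
  have hp : expo N = (N : ℝ) / (N - 1) := rfl
  rw [hp] at h' ⊢
  -- The polar equation is divided by `(N - 1) p ^ 2 = N ^ 2 / (N - 1)`.
  field_simp at h' ⊢
  linear_combination h'

/-! ### Moments of the solution and of the kernel. -/

/-- The moments of `φ` on spheres. -/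
def moment {N : ℕ} (φ : E N → ℝ) (k : ℕ) (a : E N) (s : ℝ) : ℝ :=
  ∫ ω : Sph N, φ (radius N s • (ω : E N)) * inner ℝ a (ω : E N) ^ k ∂sphMeasure N

lemma continuous_cyl {N : ℕ} {φ : E N → ℝ} (hφ : ContinuousOn φ {0}ᶜ) (s : ℝ) :
    Continuous (fun ω : Sph N => φ (radius N s • (ω : E N))) :=
  hφ.comp_continuous (continuous_radius_smul.comp (Continuous.prodMk_right s))
    (radius_smul_ne_zero s)

lemma continuous_inner_pow_sphere {N : ℕ} (a : E N) (k : ℕ) :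
    Continuous (fun ω : Sph N => inner ℝ a (ω : E N) ^ k) := by fun_prop

/-- The moments satisfy a system of radial equations. -/
lemma moment_equation {N : ℕ} (hN : 2 ≤ N) {φ : E N → ℝ} (hφ : ContDiffOn ℝ 2 φ {0}ᶜ)
    (hsol : ∀ x : E N, x ≠ 0 → linearizedOp N φ x = 0) (k : ℕ) (a : E N) :
    ∃ m₁ m₂ : ℝ → ℝ, (∀ s, HasDerivAt (moment φ k a) (m₁ s) s) ∧
      (∀ s, HasDerivAt m₁ (m₂ s) s) ∧
      ∀ s, m₂ s + ((N : ℝ) - 2) * (1 - sigmoid s) * m₁ s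
          + N * (sigmoid s * (1 - sigmoid s)) * moment φ k a s
        = ((N : ℝ) - 1) / N ^ 2 * ((k : ℝ) * (k + N - 2) * moment φ k a s
          - (k : ℝ) * (k - 1) * ‖a‖ ^ 2 * moment φ (k - 2) a s) := by
  have hopen : IsOpen ({0}ᶜ : Set (E N)) := isOpen_compl_singleton
  set Φ₁ : ℝ → Sph N → ℝ := fun s ω =>
    (expo N)⁻¹ * fderiv ℝ φ (radius N s • (ω : E N)) (radius N s • (ω : E N)) with hΦ₁
  set Φ₂ : ℝ → Sph N → ℝ := fun s ω =>
    (expo N)⁻¹ ^ 2 * (fderiv ℝ (fderiv ℝ φ) (radius N s • (ω : E N)) (radius N s • (ω : E N))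
          (radius N s • (ω : E N))
        + fderiv ℝ φ (radius N s • (ω : E N)) (radius N s • (ω : E N))) with hΦ₂
  have hne : ∀ z : ℝ × Sph N, radius N z.1 • (z.2 : E N) ∈ ({0}ᶜ : Set (E N)) := fun z =>
    radius_smul_ne_zero z.1 z.2
  have hD1 : ContDiffOn ℝ 1 (fderiv ℝ φ) {0}ᶜ := hφ.fderiv_of_isOpen hopen (by norm_num)
  have hD2 : ContinuousOn (fderiv ℝ (fderiv ℝ φ)) {0}ᶜ :=
    hD1.continuousOn_fderiv_of_isOpen hopen le_rfl
  have c1 : Continuous (Function.uncurry Φ₁) :=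
    continuous_const.mul ((hD1.continuousOn.comp_continuous continuous_radius_smul hne).clm_apply
      continuous_radius_smul)
  have c2 : Continuous (Function.uncurry Φ₂) :=
    continuous_const.mul ((((hD2.comp_continuous continuous_radius_smul hne).clm_apply
      continuous_radius_smul).clm_apply continuous_radius_smul).add
      ((hD1.continuousOn.comp_continuous continuous_radius_smul hne).clm_apply
        continuous_radius_smul))
  have ca := continuous_inner_pow_sphere a k
  have c1s : ∀ s, Continuous (Φ₁ s) := fun s => c1.comp (Continuous.prodMk_right s)
  have c2s : ∀ s, Continuous (Φ₂ s) := fun s => c2.comp (Continuous.prodMk_right s)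
  have c0s := continuous_cyl hφ.continuousOn
  refine ⟨fun s => ∫ ω : Sph N, Φ₁ s ω * inner ℝ a (ω : E N) ^ k ∂sphMeasure N,
    fun s => ∫ ω : Sph N, Φ₂ s ω * inner ℝ a (ω : E N) ^ k ∂sphMeasure N,
    fun s => ?_, fun s => ?_, fun s => ?_⟩
  · exact hasDerivAt_integral_of_continuous
      (F := fun s (ω : Sph N) => φ (radius N s • (ω : E N)) * inner ℝ a (ω : E N) ^ k)
      (F' := fun s (ω : Sph N) => Φ₁ s ω * inner ℝ a (ω : E N) ^ k)
      (fun s => (c0s s).mul ca) (c1.mul (ca.comp continuous_snd))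
      (fun s ω => (hasDerivAt_cyl hφ s ω).mul_const _) s
  · exact hasDerivAt_integral_of_continuous
      (F := fun s (ω : Sph N) => Φ₁ s ω * inner ℝ a (ω : E N) ^ k)
      (F' := fun s (ω : Sph N) => Φ₂ s ω * inner ℝ a (ω : E N) ^ k)
      (fun s => (c1s s).mul ca) (c2.mul (ca.comp continuous_snd))
      (fun s ω => (hasDerivAt_deriv_cyl hφ s ω).mul_const _) s
  · have hfs : ContDiffOn ℝ 2 (fun y : E N => φ (radius N s • y)) {0}ᶜ :=
      hφ.comp (contDiff_const_smul _).contDiffOn fun y hy =>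
        smul_ne_zero (radius_pos N s).ne' hy
    have hL := integral_sphLaplacian_mul_inner_pow hfs a k
    have i0 : Integrable (fun ω : Sph N => φ (radius N s • (ω : E N)) * inner ℝ a (ω : E N) ^ k)
      (sphMeasure N) := integrable_of_continuous_sphere ((c0s s).mul ca)
    have i1 : Integrable (fun ω : Sph N => Φ₁ s ω * inner ℝ a (ω : E N) ^ k)
      (sphMeasure N) := integrable_of_continuous_sphere ((c1s s).mul ca)
    have i2 : Integrable (fun ω : Sph N => Φ₂ s ω * inner ℝ a (ω : E N) ^ k)
      (sphMeasure N) := integrable_of_continuous_sphere ((c2s s).mul ca)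
    have hsum : ∫ ω : Sph N, Φ₂ s ω * inner ℝ a (ω : E N) ^ k ∂sphMeasure N
        + ((N : ℝ) - 2) * (1 - sigmoid s) *
          ∫ ω : Sph N, Φ₁ s ω * inner ℝ a (ω : E N) ^ k ∂sphMeasure N
        + N * (sigmoid s * (1 - sigmoid s)) * moment φ k a s
        = -(((N : ℝ) - 1) / N ^ 2) * ∫ ω : Sph N,
          sphLaplacian (fun y => φ (radius N s • y)) ω * inner ℝ a (ω : E N) ^ k
            ∂sphMeasure N := by
      have i3 : Integrable (fun ω : Sph N => Φ₂ s ω * inner ℝ a (ω : E N) ^ k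
          + ((N : ℝ) - 2) * (1 - sigmoid s) * (Φ₁ s ω * inner ℝ a (ω : E N) ^ k))
          (sphMeasure N) := i2.add (i1.const_mul _)
      rw [moment, ← integral_const_mul, ← integral_const_mul, ← integral_const_mul,
        ← integral_add i2 (i1.const_mul _), ← integral_add i3 (i0.const_mul _)]
      refine integral_congr_ae (ae_of_all _ fun ω => ?_)
      have h := cyl_equation hN hφ hsol s ω
      simp only [hΦ₁, hΦ₂]
      linear_combination inner ℝ a (ω : E N) ^ k * h
    rw [hsum, hL]
    simp only [moment]
    ring

lemma abs_moment_le {N : ℕ} {φ : E N → ℝ} (hφ : ContinuousOn φ {0}ᶜ) {B : ℝ}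
    (hB : ∀ x, |φ x| ≤ B) (k : ℕ) (a : E N) (s : ℝ) :
    |moment φ k a s| ≤ ∫ ω : Sph N, B * |inner ℝ a (ω : E N) ^ k| ∂sphMeasure N := by
  have ca := continuous_inner_pow_sphere a k
  refine abs_integral_le_integral_abs.trans (integral_mono
    (integrable_of_continuous_sphere ((continuous_cyl hφ s).mul ca).abs)
    (integrable_of_continuous_sphere (continuous_const.mul ca.abs)) fun ω => ?_)
  simp only [abs_mul]
  gcongr
  exact hB _

/-- Mixed moments of two linear functions on the sphere. -/
def mixedMoment {N : ℕ} (d : E N) (e : ℕ) (a : E N) (k : ℕ) : ℝ :=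
  ∫ ω : Sph N, inner ℝ d (ω : E N) ^ e * inner ℝ a (ω : E N) ^ k ∂sphMeasure N

/-- For `e ≤ 1` the function `⟨d, ω⟩ ^ e` is an eigenfunction of `-Δ_S` with eigenvalue `e (N - 1)`.
The resulting recursion is the one that the moments of the kernel need in order to match those of
`φ`. -/
lemma mixedMoment_recursion {N : ℕ} (d : E N) (e : ℕ) (he : e ≤ 1) (a : E N) (k : ℕ) :
    ((k : ℝ) * (k + N - 2) - e * (N - 1)) * mixedMoment d e a k
      = (k : ℝ) * (k - 1) * ‖a‖ ^ 2 * mixedMoment d e a (k - 2) := by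
  have h := integral_sphLaplacian_mul_inner_pow (contDiff_inner_pow d e (n := 2)).contDiffOn a k
  have h1 : ∀ ω : Sph N, sphLaplacian (fun x : E N => inner ℝ d x ^ e) ω
      = -((e : ℝ) * (N - 1)) * inner ℝ d (ω : E N) ^ e := fun ω => by
    rw [sphLaplacian_inner_pow]
    interval_cases e
    · simp
    · simp; ring
  simp only [h1, mul_assoc] at h
  rw [integral_const_mul] at h
  simp only [mixedMoment]
  linear_combination h

lemma mixedMoment_zero_left {N : ℕ} (d a : E N) (k : ℕ) :
    mixedMoment d 0 a k = ∫ ω : Sph N, inner ℝ a (ω : E N) ^ k ∂sphMeasure N := by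
  simp [mixedMoment]

lemma sphere_measure_pos {N : ℕ} (hN : 2 ≤ N) : 0 < (sphMeasure N).real Set.univ := by
  have : Nonempty (Fin N) := ⟨⟨0, by omega⟩⟩
  rw [measureReal_def, ENNReal.toReal_pos_iff]
  exact ⟨Measure.measure_univ_pos.2 (Measure.toSphere_ne_zero _), measure_lt_top _ _⟩

/-- The recursion with `e = 0` and `k = 2` relates the second moment to the total mass. -/
lemma integral_inner_sq {N : ℕ} (hN : 2 ≤ N) (a : E N) :
    ∫ ω : Sph N, inner ℝ a (ω : E N) ^ 2 ∂sphMeasure N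
      = ‖a‖ ^ 2 * ((sphMeasure N).real Set.univ / N) := by
  have h := mixedMoment_recursion a 0 (by norm_num) a 2
  have hN0 : (N : ℝ) ≠ 0 := by positivity
  rw [mixedMoment_zero_left, mixedMoment_zero_left] at h
  simp at h
  field_simp
  simp only [Measure.toSphere_real_apply_univ, finrank_euclideanSpace_fin]
  linarith

/-- Polarization of `integral_inner_sq`. -/
lemma integral_inner_mul_inner {N : ℕ} (hN : 2 ≤ N) (a d : E N) :
    mixedMoment d 1 a 1 = inner ℝ a d * ((sphMeasure N).real Set.univ / N) := by
  have h1 := integral_inner_sq hN (a + d)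
  have h2 := integral_inner_sq hN a
  have h3 := integral_inner_sq hN d
  have ci : ∀ b : E N, Integrable (fun ω : Sph N => inner ℝ b (ω : E N) ^ 2) (sphMeasure N) :=
    fun b => integrable_of_continuous_sphere (continuous_inner_pow_sphere b 2)
  have cm : Integrable (fun ω : Sph N => inner ℝ d (ω : E N) ^ 1 * inner ℝ a (ω : E N) ^ 1)
      (sphMeasure N) := integrable_of_continuous_sphere
    ((continuous_inner_pow_sphere d 1).mul (continuous_inner_pow_sphere a 1))
  have he : ∀ ω : Sph N, inner ℝ (a + d) (ω : E N) ^ 2 = inner ℝ a (ω : E N) ^ 2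
      + 2 * (inner ℝ d (ω : E N) ^ 1 * inner ℝ a (ω : E N) ^ 1) + inner ℝ d (ω : E N) ^ 2 :=
    fun ω => by rw [inner_add_left]; ring
  simp only [he] at h1
  have cs : Integrable (fun ω : Sph N => inner ℝ a (ω : E N) ^ 2
      + 2 * (inner ℝ d (ω : E N) ^ 1 * inner ℝ a (ω : E N) ^ 1)) (sphMeasure N) :=
    (ci a).add (cm.const_mul 2)
  rw [integral_add cs (ci d), integral_add (ci a) (cm.const_mul 2),
    integral_const_mul, h2, h3, norm_add_sq_real] at h1
  rw [mixedMoment]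
  linarith

/-- The part of the kernel spanned by `Z_0, …, Z_N`, in the variables `(s, ω)`. -/
def kernelPart {N : ℕ} (d₀ : ℝ) (d : E N) (s : ℝ) (ω : Sph N) : ℝ :=
  d₀ * scaleProfile N s + transProfile N s * inner ℝ d (ω : E N)

/-- The moments of `φ` minus an element of the kernel. -/
lemma integral_sub_kernelPart {N : ℕ} {φ : E N → ℝ} (hφ : ContinuousOn φ {0}ᶜ) (d₀ : ℝ)
    (d : E N) (s : ℝ) (a : E N) (k : ℕ) :
    ∫ ω : Sph N, (φ (radius N s • (ω : E N)) - kernelPart d₀ d s ω) * inner ℝ a (ω : E N) ^ k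
        ∂sphMeasure N
      = moment φ k a s - d₀ * mixedMoment d 0 a k * scaleProfile N s
        - mixedMoment d 1 a k * transProfile N s := by
  have ca := continuous_inner_pow_sphere a k
  have i0 : Integrable (fun ω : Sph N => φ (radius N s • (ω : E N)) * inner ℝ a (ω : E N) ^ k)
      (sphMeasure N) := integrable_of_continuous_sphere ((continuous_cyl hφ s).mul ca)
  have ie : ∀ e, Integrable (fun ω : Sph N => inner ℝ d (ω : E N) ^ e * inner ℝ a (ω : E N) ^ k)
      (sphMeasure N) := fun e =>
    integrable_of_continuous_sphere ((continuous_inner_pow_sphere d e).mul ca)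
  have i1 : Integrable (fun ω : Sph N => φ (radius N s • (ω : E N)) * inner ℝ a (ω : E N) ^ k
      - d₀ * scaleProfile N s * (inner ℝ d (ω : E N) ^ 0 * inner ℝ a (ω : E N) ^ k))
      (sphMeasure N) := i0.sub ((ie 0).const_mul _)
  have he : ∀ ω : Sph N,
      (φ (radius N s • (ω : E N)) - kernelPart d₀ d s ω) * inner ℝ a (ω : E N) ^ k
      = φ (radius N s • (ω : E N)) * inner ℝ a (ω : E N) ^ k
      - d₀ * scaleProfile N s * (inner ℝ d (ω : E N) ^ 0 * inner ℝ a (ω : E N) ^ k)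
      - transProfile N s * (inner ℝ d (ω : E N) ^ 1 * inner ℝ a (ω : E N) ^ k) := fun ω => by
    rw [kernelPart]; ring
  simp only [he]
  rw [integral_sub i1 ((ie 1).const_mul _), integral_sub i0 ((ie 0).const_mul _),
    integral_const_mul, integral_const_mul]
  simp only [moment, mixedMoment]
  ring

/-- Once the moments of degrees zero and one vanish, so do all of them. -/
lemma moments_eq_kernelPart {N : ℕ} (hN : 2 ≤ N) {φ : E N → ℝ} (hφ : ContDiffOn ℝ 2 φ {0}ᶜ)
    (hsol : ∀ x : E N, x ≠ 0 → linearizedOp N φ x = 0) {B : ℝ} (hB : ∀ x, |φ x| ≤ B)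
    {d₀ : ℝ} {d a : E N}
    (h0 : ∀ s, moment φ 0 a s - d₀ * mixedMoment d 0 a 0 * scaleProfile N s
      - mixedMoment d 1 a 0 * transProfile N s = 0)
    (h1 : ∀ s, moment φ 1 a s - d₀ * mixedMoment d 0 a 1 * scaleProfile N s
      - mixedMoment d 1 a 1 * transProfile N s = 0) (k : ℕ) :
    ∀ s, moment φ k a s - d₀ * mixedMoment d 0 a k * scaleProfile N s
      - mixedMoment d 1 a k * transProfile N s = 0 := by
  have hN' : (2 : ℝ) ≤ N := by exact_mod_cast hN
  have hN0 : (0 : ℝ) < N := by linarith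
  induction k using Nat.strong_induction_on with
  | _ k ih =>
  rcases Nat.lt_or_ge k 2 with hk | hk
  · interval_cases k
    · exact h0
    · exact h1
  have hk' : (2 : ℝ) ≤ k := by exact_mod_cast hk
  have hprev := ih (k - 2) (by omega)
  obtain ⟨m₁, m₂, hm₁, hm₂, hm⟩ := moment_equation hN hφ hsol k a
  have hZ := isRadialSol_scaleProfile hN
  have hT := isRadialSol_transProfile hN
  have r0 := mixedMoment_recursion d 0 (by norm_num) a k
  have r1 := mixedMoment_recursion d 1 le_rfl a k
  -- By `r0` and `r1` the subtracted terms carry the same kind of source as the moment. The total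
  -- source is then a multiple of the difference in degree `k - 2`, which is zero by `hprev`.
  have hD : IsRadialSol N (((N : ℝ) - 1) / N ^ 2 * (k * (k + N - 2)))
      (fun s => moment φ k a s - d₀ * mixedMoment d 0 a k * scaleProfile N s
        - mixedMoment d 1 a k * transProfile N s) _ _ :=
    { hasDerivAt := fun s => ((hm₁ s).sub ((hZ.hasDerivAt s).const_mul _)).sub
        ((hT.hasDerivAt s).const_mul _)
      hasDerivAt' := fun s => ((hm₂ s).sub ((hZ.hasDerivAt' s).const_mul _)).sub
        ((hT.hasDerivAt' s).const_mul _)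
      eqn := fun s => by
        have e1 := hm s
        have e2 := hZ.eqn s
        have e3 := hT.eqn s
        have e4 := hprev s
        have e5 : ((N : ℝ) - 1) ^ 2 / N ^ 2 = ((N : ℝ) - 1) / N ^ 2 * (N - 1) := by ring
        rw [e5] at e3
        push_cast at r0 r1
        linear_combination e1 - d₀ * mixedMoment d 0 a k * e2 - mixedMoment d 1 a k * e3
          + ((N : ℝ) - 1) / N ^ 2 * (d₀ * scaleProfile N s * r0 + transProfile N s * r1)
          - ((N : ℝ) - 1) / N ^ 2 * (k * (k - 1) * ‖a‖ ^ 2) * e4 }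
  refine hD.eq_zero hN (B := (∫ ω : Sph N, B * |inner ℝ a (ω : E N) ^ k| ∂sphMeasure N)
    + |d₀ * mixedMoment d 0 a k| * (1 + (N : ℝ) / ((N : ℝ) - 1)) + |mixedMoment d 1 a k| * 1)
    (fun s => ?_) ?_
  · refine (abs_sub _ _).trans (add_le_add ((abs_sub _ _).trans (add_le_add
      (abs_moment_le hφ.continuousOn hB k a s) ?_)) ?_)
    · rw [abs_mul]
      exact mul_le_mul_of_nonneg_left (abs_scaleProfile_le hN s) (abs_nonneg _)
    · rw [abs_mul]
      exact mul_le_mul_of_nonneg_left (abs_transProfile_le hN s) (abs_nonneg _)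
  -- What remains is `N - 1 < k (k + N - 2)`, which holds since `k ≥ 2`.
  · rw [sq ((N : ℝ) - 1), mul_div_right_comm]
    refine mul_lt_mul_of_pos_left ?_ (div_pos (by linarith) (by positivity))
    nlinarith

/-- Classification of bounded solutions in the variables `(s, ω)`. -/
lemma exists_eq_kernelPart {N : ℕ} (hN : 2 ≤ N) {φ : E N → ℝ} (hφ : ContDiffOn ℝ 2 φ {0}ᶜ)
    (hsol : ∀ x : E N, x ≠ 0 → linearizedOp N φ x = 0) {B : ℝ} (hB : ∀ x, |φ x| ≤ B) :
    ∃ (d₀ : ℝ) (d : E N), ∀ s (ω : Sph N),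
      φ (radius N s • (ω : E N)) = kernelPart d₀ d s ω := by
  have hN' : (2 : ℝ) ≤ N := by exact_mod_cast hN
  have hN0 : (N : ℝ) ≠ 0 := by linarith
  set V := (sphMeasure N).real Set.univ with hV
  have hVpos : 0 < V := sphere_measure_pos hN
  have hbd := fun k a => abs_moment_le hφ.continuousOn hB k a
  obtain ⟨c₀, hc₀⟩ : ∃ c, ∀ s, moment φ 0 (0 : E N) s = c * scaleProfile N s := by
    obtain ⟨m₁, m₂, hm₁, hm₂, hm⟩ := moment_equation hN hφ hsol 0 0
    exact IsRadialSol.eq_scaleProfile hN ⟨hm₁, hm₂, fun s => by rw [hm s]; simp⟩ (hbd 0 0)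
  have hc₁ : ∀ a : E N, ∃ c, ∀ s, moment φ 1 a s = c * transProfile N s := fun a => by
    obtain ⟨m₁, m₂, hm₁, hm₂, hm⟩ := moment_equation hN hφ hsol 1 a
    exact IsRadialSol.eq_transProfile hN
      ⟨hm₁, hm₂, fun s => by rw [hm s]; push_cast; ring⟩ (hbd 1 a)
  choose c hc using hc₁
  -- The normalizations invert `∫ 1 = V` and `∫ ⟨d, ω⟩ ⟨a, ω⟩ = ⟨a, d⟩ V / N`, so that the moments
  -- of degrees 0 and 1 agree.
  set d₀ := c₀ / V
  set d : E N := WithLp.toLp 2 fun i => N / V * c (EuclideanSpace.single i 1) with hd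
  refine ⟨d₀, d, fun s ω => ?_⟩
  have hmix00 : ∀ a, mixedMoment d 0 a 0 = V := fun a => by
    simp only [mixedMoment, pow_zero, mul_one, integral_const, smul_eq_mul, hV]
  have hmix10 : ∀ a, mixedMoment d 1 a 0 = 0 := fun a => by
    have h := mixedMoment_recursion d 1 le_rfl a 0
    have : ((N : ℝ) - 1) * mixedMoment d 1 a 0 = 0 := by
      push_cast at h
      linear_combination -h
    exact (mul_eq_zero.1 this).resolve_left (by linarith)
  have hmix01 : ∀ a, mixedMoment d 0 a 1 = 0 := fun a => by
    have h := mixedMoment_recursion d 0 (by norm_num) a 1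
    have : ((N : ℝ) - 1) * mixedMoment d 0 a 1 = 0 := by
      push_cast at h
      linear_combination h
    exact (mul_eq_zero.1 this).resolve_left (by linarith)
  -- The chosen `c` is not known to be linear in `a`. Linearity of the first moment allows only its
  -- values on the basis to be used.
  have hlin : ∀ a s, moment φ 1 a s = (∑ i, a i * c (EuclideanSpace.single i 1))
      * transProfile N s := fun a s => by
    have h1 : ∀ ω : Sph N, φ (radius N s • (ω : E N)) * inner ℝ a (ω : E N) ^ 1
        = ∑ i, a i * (φ (radius N s • (ω : E N))
          * inner ℝ (EuclideanSpace.single i (1 : ℝ)) (ω : E N) ^ 1) := fun ω => by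
      have := sum_apply_single ((innerSL ℝ).flip (ω : E N)) a
      simp only [ContinuousLinearMap.flip_apply, innerSL_apply_apply] at this
      rw [pow_one, ← this, Finset.mul_sum]
      exact Finset.sum_congr rfl fun i _ => by ring
    have hci := fun i : Fin N => hc (EuclideanSpace.single i 1) s
    simp only [moment] at hci ⊢
    simp only [h1]
    have hi : ∀ i : Fin N, Integrable (fun ω : Sph N => φ (radius N s • (ω : E N))
        * inner ℝ (EuclideanSpace.single i (1 : ℝ)) (ω : E N) ^ 1) (sphMeasure N) := fun i =>
      integrable_of_continuous_sphere
        ((continuous_cyl hφ.continuousOn s).mul (continuous_inner_pow_sphere _ 1))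
    rw [integral_finsetSum _ fun i _ => (hi i).const_mul (a i), Finset.sum_mul]
    refine Finset.sum_congr rfl fun i _ => ?_
    rw [integral_const_mul, hci]
    ring
  have hmix11 : ∀ a, mixedMoment d 1 a 1 = ∑ i, a i * c (EuclideanSpace.single i 1) :=
    fun a => by
      have h := sum_apply_single ((innerSL ℝ).flip d) a
      simp only [ContinuousLinearMap.flip_apply, innerSL_apply_apply] at h
      rw [integral_inner_mul_inner hN, ← hV, ← h, Finset.sum_mul]
      refine Finset.sum_congr rfl fun i _ => ?_
      rw [EuclideanSpace.inner_single_left, hd]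
      simp
      field_simp
  have hall : ∀ a k, moment φ k a s - d₀ * mixedMoment d 0 a k * scaleProfile N s
      - mixedMoment d 1 a k * transProfile N s = 0 := fun a k => by
    refine moments_eq_kernelPart hN hφ hsol hB (fun t => ?_) (fun t => ?_) k s
    · have h0 : moment φ 0 a t = moment φ 0 (0 : E N) t := by simp [moment]
      rw [h0, hc₀, hmix00, hmix10]
      simp only [d₀]
      field_simp
      ring
    · rw [hlin, hmix01, hmix11]
      ring
  have hz := eq_zero_of_moments
    (F := fun ω : Sph N => φ (radius N s • (ω : E N)) - kernelPart d₀ d s ω)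
    ((continuous_cyl hφ.continuousOn s).sub (by unfold kernelPart; fun_prop))
    (fun a k => (integral_sub_kernelPart hφ.continuousOn d₀ d s a k).trans (hall a k))
  exact sub_eq_zero.1 (congrFun hz ω)

/-! ### Return to `Z_0, …, Z_N` and the conclusion. -/

lemma Zscale_eq {N : ℕ} (hN : 2 ≤ N) (x : E N) :
    Zscale N x = N * (1 - expo N * sigmaR N ‖x‖) := by
  have h : ‖x‖ ^ (expo N - 2) * ‖x‖ ^ 2 = ‖x‖ ^ expo N := by
    rcases eq_or_ne x 0 with rfl | hx
    · simp [zero_rpow (expo_pos hN).ne']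
    · rw [← rpow_natCast, ← rpow_add (norm_pos_iff.2 hx)]
      congr 1
      push_cast; ring
  rw [Zscale, gradient_bubble hN, inner_smul_right, real_inner_self_eq_norm_sq, sigmaR, ← h]
  ring

lemma Ztrans_eq {N : ℕ} (hN : 2 ≤ N) (i : Fin N) (x : E N) :
    Ztrans N i x = -(N * expo N) * (‖x‖ ^ (expo N - 2) / (1 + ‖x‖ ^ expo N) * x i) := by
  rw [Ztrans, partialDeriv, ← gradient_apply_coord, gradient_bubble hN]
  simp
  ring

lemma sum_mul_Ztrans {N : ℕ} (hN : 2 ≤ N) (d x : E N) :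
    ∑ i, -(d i / (N * expo N)) * Ztrans N i x
      = ‖x‖ ^ (expo N - 2) / (1 + ‖x‖ ^ expo N) * inner ℝ d x := by
  have hN0 : (N : ℝ) ≠ 0 := by positivity
  have hp := (expo_pos hN).ne'
  have h := sum_apply_single ((innerSL ℝ) d) x
  simp only [innerSL_apply_apply] at h
  rw [← h, Finset.mul_sum]
  refine Finset.sum_congr rfl fun i _ => ?_
  rw [Ztrans_eq hN, EuclideanSpace.inner_single_right]
  simp
  field_simp

/-- An essentially bounded continuous function is bounded. -/
lemma exists_bound_of_memLp_top {N : ℕ} {φ : E N → ℝ} (hbdd : MemLp φ ∞ volume)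
    (hcont : Continuous φ) : ∃ B, ∀ x, |φ x| ≤ B := by
  have hlt : eLpNormEssSup φ volume < ∞ := by
    rw [← eLpNorm_exponent_top]
    exact hbdd.2
  refine ⟨(eLpNormEssSup φ volume).toReal, fun x => ?_⟩
  have hdense : Dense {x : E N | |φ x| ≤ (eLpNormEssSup φ volume).toReal} := by
    refine Measure.dense_of_ae (μ := volume) ?_
    filter_upwards [ae_le_eLpNormEssSup (f := φ) (μ := volume)] with y hy
    have := ENNReal.toReal_mono hlt.ne hy
    rwa [toReal_enorm, Real.norm_eq_abs] at this
  exact (isClosed_le hcont.abs continuous_const).closure_subset (hdense x)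

end NLiouville

end

/-- Nondegeneracy of the Liouville bubble. The equation is imposed away from the origin, the only
zero of `∇U`, where the coefficients of `L` are singular, and `φ` is required to be `C²` only there
(and continuous on `ℝ^N`). This class contains every bounded `C²` function on `ℝ^N`, and also
`Z_0, …, Z_N`, which for `N ≥ 3` are not `C²` at the origin. -/
theorem theorem1p1 (N : ℕ) (hN : 2 ≤ N) (φ : NLiouville.E N → ℝ)
    (hbdd : MemLp φ ∞ volume)
    (hcont : Continuous φ)
    (hC2 : ContDiffOn ℝ 2 φ {0}ᶜ)
    (hsol : ∀ x : NLiouville.E N, x ≠ 0 → NLiouville.linearizedOp N φ x = 0) :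
    ∃ (c₀ : ℝ) (c : Fin N → ℝ), ∀ x : NLiouville.E N,
      φ x = c₀ * NLiouville.Zscale N x + ∑ i, c i * NLiouville.Ztrans N i x := by
  open NLiouville in
  obtain ⟨B, hB⟩ := exists_bound_of_memLp_top hbdd hcont
  obtain ⟨d₀, d, hd⟩ := exists_eq_kernelPart hN hC2 hsol hB
  have hN' : (2 : ℝ) ≤ N := by exact_mod_cast hN
  have hN0 : (N : ℝ) ≠ 0 := by linarith
  have hN1 : (N : ℝ) - 1 ≠ 0 := by linarith
  have hp := expo_pos hN
  have hform : ∀ x : E N, x ≠ 0 → φ x = d₀ * (1 - expo N * sigmaR N ‖x‖)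
      + ‖x‖ ^ (expo N - 2) / (1 + ‖x‖ ^ expo N) * inner ℝ d x := by
    intro x hx
    have hr : 0 < ‖x‖ := norm_pos_iff.2 hx
    set s : ℝ := expo N * Real.log ‖x‖ with hs
    have hrad : radius N s = ‖x‖ := by
      rw [radius, hs, mul_div_cancel_left₀ _ hp.ne', Real.exp_log hr]
    have h := hd s ⟨‖x‖⁻¹ • x, by simp [norm_smul, hx]⟩
    simp only [hrad, smul_smul, mul_inv_cancel₀ hr.ne', one_smul, kernelPart] at h
    have h1 : scaleProfile N s = 1 - expo N * sigmaR N ‖x‖ := by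
      rw [← hrad, sigmaR_radius hN]; rfl
    have h2 : transProfile N s * ‖x‖⁻¹ = ‖x‖ ^ (expo N - 2) / (1 + ‖x‖ ^ expo N) := by
      -- Here `p / N = 1 / (N - 1) = p - 1`.
      have h3 : Real.exp (s / N) = ‖x‖ ^ (expo N - 1) := by
        rw [Real.rpow_def_of_pos hr, hs]
        congr 1
        rw [expo]
        field_simp
        ring
      rw [transProfile_eq, h3, ← radius_rpow hN, hrad, show expo N - 2 = expo N - 1 - 1 by ring,
        Real.rpow_sub_one hr.ne' (expo N - 1)]
      ring
    rw [h, h1, inner_smul_right, ← h2]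
    ring
  refine ⟨d₀ / N, fun i => -(d i / (N * expo N)), fun x => ?_⟩
  rw [sum_mul_Ztrans hN, Zscale_eq hN]
  have hsimp : d₀ / N * (N * (1 - expo N * sigmaR N ‖x‖)) = d₀ * (1 - expo N * sigmaR N ‖x‖) := by
    field_simp
  rw [hsimp]
  rcases eq_or_ne x 0 with rfl | hx
  · have : Nonempty (Fin N) := ⟨⟨0, by omega⟩⟩
    -- At the origin the formula follows by continuity of the even part: in `φ y + φ (-y)` the odd
    -- term cancels, and with it the factor `‖y‖ ^ (p - 2)`, singular for `N ≥ 3`.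
    have hcont' : Continuous fun y : E N => 2 * (d₀ * (1 - expo N * sigmaR N ‖y‖)) := by
      unfold sigmaR
      have hc : Continuous fun y : E N => ‖y‖ ^ expo N :=
        continuous_norm.rpow_const fun _ => Or.inr hp.le
      exact continuous_const.mul (continuous_const.mul (continuous_const.sub
        (continuous_const.mul (hc.div (continuous_const.add hc)
          fun y => (one_add_norm_rpow_pos y _).ne'))))
    have hsum : Continuous fun y : E N => φ y + φ (-y) := hcont.add (hcont.comp continuous_neg)
    have heq := hsum.ext_on (dense_compl_singleton (0 : E N)) hcont' fun y hy => by
      simp only [hform y hy, hform (-y) (neg_ne_zero.2 hy), norm_neg, inner_neg_right]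
      ring
    have h0 := congrFun heq 0
    simp only [neg_zero] at h0
    rw [inner_zero_right]
    linarith
  · exact hform x hx
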